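/- For a finite simple undirected graph $G=(V,E)$ with $|V|=n$ and an integer $0\le k\le n$, the feasible solutions of \textsc{max} (resp. \textsc{min}) $(k,n-k)$-cut are the sets $S\subseteq V$ with $|S|=k$; the value of $S$ is the number of edges with exactly one endpoint in $S$, and it is to be maximized (resp. minimized). Let $\mathrm{opt}(G,k)$ be the optimal value. The model of computation is a random access machine over the natural numbers with unit-cost addition, truncated subtraction, tests for zero and indirect addressing (in the randomized case, also fair coin tosses); a graph is given by its adjacency matrix. (1) \textsc{Max} $(k,n-k)$-cut parameterized by $k$ has a fixed-parameter approximation schema: there are a deterministic algorithm, a computable function $f$ and a constant $c$ such that, for every rational $\varepsilon>0$, every $n$, every $k\le n$ and every graph $G$ on $n$ vertices, the algorithm on input $(G,k,\varepsilon)$ outputs, within $f(k,\varepsilon)\cdot(n+1)^{c}$ steps, a set of exactly $k$ vertices of value at least $(1-\varepsilon)\,\mathrm{opt}(G,k)$. (2) \textsc{Min} $(k,n-k)$-cut parameterized by $k$ has a randomized fixed-parameter approximation schema: there are a randomized algorithm, a computable function $f$ and a constant $c$ such that, for every rational $\varepsilon>0$, every $n$, every $k\le n$ and every graph $G$ on $n$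 vertices, the algorithm on input $(G,k,\varepsilon)$ always outputs, within $f(k,\varepsilon)\cdot(n+1)^{c}$ steps, a set of exactly $k$ vertices, and with probability at least $2/3$ the value of this set is at most $(1+\varepsilon)\,\mathrm{opt}(G,k)$. -/

import Mathlib

/-! ## A random access machine with a step count -/

/-- Arithmetic expressions of a random access machine with finitely many registers and finitely
many unbounded arrays (registers and arrays are named by natural numbers). All values are natural
numbers; the only arithmetic is addition and truncated subtraction. -/
inductive RExpr : Type
  /-- a constant -/
  | lit (c : ℕ) : RExpr
  /-- the content of register `x` -/
  | reg (x : ℕ) : RExpr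
  /-- the cell of array `a` whose index is the value of `i` -/
  | get (a : ℕ) (i : RExpr) : RExpr
  | add (e₁ e₂ : RExpr) : RExpr
  | sub (e₁ e₂ : RExpr) : RExpr

/-- Structured programs of the machine. -/
inductive RProg : Type
  | skip : RProg
  /-- `x := e` -/
  | assign (x : ℕ) (e : RExpr) : RProg
  /-- `a[i] := e` -/
  | put (a : ℕ) (i e : RExpr) : RProg
  /-- toss a fair coin and write the result, 0 or 1, into register `x` -/
  | flip (x : ℕ) : RProg
  | seq (p q : RProg) : RProg
  /-- run `p` if the value of `e` is nonzero, otherwise `q` -/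
  | cond (e : RExpr) (p q : RProg) : RProg
  /-- repeat `p` as long as the value of `e` is nonzero -/
  | loop (e : RExpr) (p : RProg) : RProg

/-- A configuration: registers, arrays, and the outcomes of the coin tosses still to come. -/
@[ext] structure RState : Type where
  reg : ℕ → ℕ
  arr : ℕ → ℕ → ℕ
  coins : ℕ → Bool

/-- The value of an expression. -/
def RExpr.eval (s : RState) : RExpr → ℕ
  | .lit c => c
  | .reg x => s.reg x
  | .get a i => s.arr a (i.eval s)
  | .add e₁ e₂ => e₁.eval s + e₂.eval s
  | .sub e₁ e₂ => e₁.eval s - e₂.eval s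

/-- The number of steps needed to evaluate an expression: one for each node. -/
def RExpr.cost : RExpr → ℕ
  | .lit _ => 1
  | .reg _ => 1
  | .get _ i => i.cost + 1
  | .add e₁ e₂ => e₁.cost + e₂.cost + 1
  | .sub e₁ e₂ => e₁.cost + e₂.cost + 1

/-- `RExec p s s' t`: program `p`, started in configuration `s`, halts in configuration `s'` after
exactly `t` steps. A program that does not halt from `s` is related to no `s'` and `t`. -/
inductive RExec : RProg → RState → RState → ℕ → Prop
  | skip (s : RState) : RExec .skip s s 1
  | assign (x : ℕ) (e : RExpr) (s : RState) :
      RExec (.assign x e) s { s with reg := Function.update s.reg x (e.eval s) } (e.cost + 1)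
  | put (a : ℕ) (i e : RExpr) (s : RState) :
      RExec (.put a i e) s
        { s with arr := Function.update s.arr a
                          (Function.update (s.arr a) (i.eval s) (e.eval s)) }
        (i.cost + e.cost + 1)
  | flip (x : ℕ) (s : RState) :
      RExec (.flip x) s
        { s with reg := Function.update s.reg x (s.coins 0).toNat
                 coins := fun j => s.coins (j + 1) } 1
  | seq {p q : RProg} {s₁ s₂ s₃ : RState} {t₁ t₂ : ℕ} :
      RExec p s₁ s₂ t₁ → RExec q s₂ s₃ t₂ → RExec (.seq p q) s₁ s₃ (t₁ + t₂)
  | cond_true {e : RExpr} {p q : RProg} {s s' : RState} {t : ℕ} :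
      e.eval s ≠ 0 → RExec p s s' t → RExec (.cond e p q) s s' (e.cost + 1 + t)
  | cond_false {e : RExpr} {p q : RProg} {s s' : RState} {t : ℕ} :
      e.eval s = 0 → RExec q s s' t → RExec (.cond e p q) s s' (e.cost + 1 + t)
  | loop_true {e : RExpr} {p : RProg} {s₁ s₂ s₃ : RState} {t₁ t₂ : ℕ} :
      e.eval s₁ ≠ 0 → RExec p s₁ s₂ t₁ → RExec (.loop e p) s₂ s₃ t₂ →
        RExec (.loop e p) s₁ s₃ (e.cost + 1 + t₁ + t₂)
  | loop_false {e : RExpr} {p : RProg} {s : RState} :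
      e.eval s = 0 → RExec (.loop e p) s s (e.cost + 1)

/-- For given coin tosses a run is deterministic: result and number of steps are unique. -/
theorem RExec.unique {p : RProg} {s s₁ s₂ : RState} {t₁ t₂ : ℕ}
    (h₁ : RExec p s s₁ t₁) (h₂ : RExec p s s₂ t₂) : s₁ = s₂ ∧ t₁ = t₂ := by
  induction h₁ generalizing s₂ t₂ with
  | skip s => cases h₂; exact ⟨rfl, rfl⟩
  | assign x e s => cases h₂; exact ⟨rfl, rfl⟩
  | put a i e s => cases h₂; exact ⟨rfl, rfl⟩
  | flip x s => cases h₂; exact ⟨rfl, rfl⟩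
  | seq _ _ ih₁ ih₂ =>
    cases h₂ with
    | seq a b =>
      obtain ⟨rfl, rfl⟩ := ih₁ a
      obtain ⟨rfl, rfl⟩ := ih₂ b
      exact ⟨rfl, rfl⟩
  | cond_true h _ ih =>
    cases h₂ with
    | cond_true _ a => obtain ⟨rfl, rfl⟩ := ih a; exact ⟨rfl, rfl⟩
    | cond_false h' _ => exact absurd h' h
  | cond_false h _ ih =>
    cases h₂ with
    | cond_true h' _ => exact absurd h h'
    | cond_false _ a => obtain ⟨rfl, rfl⟩ := ih a; exact ⟨rfl, rfl⟩
  | loop_true h _ _ ih₁ ih₂ =>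
    cases h₂ with
    | loop_true _ a b =>
      obtain ⟨rfl, rfl⟩ := ih₁ a
      obtain ⟨rfl, rfl⟩ := ih₂ b
      exact ⟨rfl, rfl⟩
    | loop_false h' => exact absurd h' h
  | loop_false h =>
    cases h₂ with
    | loop_true h' _ _ => exact absurd h h'
    | loop_false _ => exact ⟨rfl, rfl⟩

/-- A deterministic program: it contains no coin toss. -/
def RProg.CoinFree : RProg → Prop
  | .skip => True
  | .assign _ _ => True
  | .put _ _ _ => True
  | .flip _ => False
  | .seq p q => p.CoinFree ∧ q.CoinFree
  | .cond _ p q => p.CoinFree ∧ q.CoinFree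
  | .loop _ p => p.CoinFree

/-- The law of an infinite sequence of independent fair coin tosses. -/
noncomputable def coinMeasure : MeasureTheory.Measure (ℕ → Bool) :=
  MeasureTheory.Measure.infinitePi fun _ => (PMF.uniformOfFintype Bool).toMeasure

/-! ## The problems max and min `(k, n - k)`-cut -/

open Classical in
/-- The number of edges of `G` with exactly one endpoint in `S`. -/
noncomputable def cutValue {n : ℕ} (G : SimpleGraph (Fin n)) (S : Finset (Fin n)) : ℕ :=
  (G.interedges S Sᶜ).card

/-- Whether the size of the cut is to be maximized or minimized. -/
inductive CutGoal : Type
  | max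
  | min

/-- `S` is a set of exactly `k` vertices whose cut is, with respect to the optimum over all sets of
`k` vertices, a `(1 - ε)`-approximation (maximization) or a `(1 + ε)`-approximation
(minimization). -/
def IsApproxCut (goal : CutGoal) {n : ℕ} (G : SimpleGraph (Fin n)) (k : ℕ) (ε : ℚ)
    (S : Finset (Fin n)) : Prop :=
  S.card = k ∧ ∀ W : Finset (Fin n), W.card = k →
    match goal with
    | .max => (1 - ε) * (cutValue G W : ℚ) ≤ (cutValue G S : ℚ)
    | .min => (cutValue G S : ℚ) ≤ (1 + ε) * (cutValue G W : ℚ)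

open Classical in
/-- The initial configuration on the input `(G, k, ε)`: the registers 0, 1, 2, 3 hold the number of
vertices, `k`, and the numerator and the denominator of `ε`; the array 0 holds the adjacency matrix
of `G`, row by row; everything else is 0. -/
noncomputable def cutInput {n : ℕ} (G : SimpleGraph (Fin n)) (k : ℕ) (ε : ℚ)
    (coins : ℕ → Bool) : RState where
  reg x := if x = 0 then n else if x = 1 then k else if x = 2 then ε.num.natAbs
    else if x = 3 then ε.den else 0
  arr a i := if a = 0 ∧ ∃ u v : Fin n, G.Adj u v ∧ i = (u : ℕ) * n + (v : ℕ) then 1 else 0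
  coins := coins

/-- The set of vertices that a halting configuration outputs: its characteristic vector is in
the array 1. -/
def cutOutput (n : ℕ) (s : RState) : Finset (Fin n) :=
  Finset.univ.filter fun v => s.arr 1 (v : ℕ) ≠ 0

/-- The number of steps allowed for an instance with `n` vertices: `f(k, ε) · (n + 1) ^ c`, where
`ε` is handed to `f` through its numerator and denominator in lowest terms. -/
def fptBound (f : ℕ × ℕ × ℕ → ℕ) (c n k : ℕ) (ε : ℚ) : ℕ :=
  f (k, ε.num.natAbs, ε.den) * (n + 1) ^ c

/-- `(k, n - k)`-cut, parameterized by `k`, has a fixed-parameter approximation schema: a single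
deterministic program that, given a graph with `n` vertices, `k ≤ n` and a rational `ε > 0`, finds a
`(1 ± ε)`-approximate solution in `f(k, ε) · n ^ O(1)` steps, with `f` computable. -/
def HasFPTApproxSchema (goal : CutGoal) : Prop :=
  ∃ (P : RProg) (f : ℕ × ℕ × ℕ → ℕ) (c : ℕ), P.CoinFree ∧ Computable f ∧
    ∀ ε : ℚ, 0 < ε → ∀ n k : ℕ, k ≤ n → ∀ G : SimpleGraph (Fin n),
      ∃ (s : RState) (t : ℕ), RExec P (cutInput G k ε fun _ => false) s t ∧
        t ≤ fptBound f c n k ε ∧ IsApproxCut goal G k ε (cutOutput n s)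

/-- `(k, n - k)`-cut, parameterized by `k`, has a randomized fixed-parameter approximation schema:
whatever the coins show, the program halts in time and outputs `k` vertices, and with probability at
least `2/3` these are a `(1 ± ε)`-approximate solution. -/
def HasRandomizedFPTApproxSchema (goal : CutGoal) : Prop :=
  ∃ (P : RProg) (f : ℕ × ℕ × ℕ → ℕ) (c : ℕ), Computable f ∧
    ∀ ε : ℚ, 0 < ε → ∀ n k : ℕ, k ≤ n → ∀ G : SimpleGraph (Fin n),
      (∀ coins : ℕ → Bool, ∃ (s : RState) (t : ℕ), RExec P (cutInput G k ε coins) s t ∧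
        t ≤ fptBound f c n k ε ∧ (cutOutput n s).card = k) ∧
      2 / 3 ≤ coinMeasure {coins | ∃ (s : RState) (t : ℕ), RExec P (cutInput G k ε coins) s t ∧
        IsApproxCut goal G k ε (cutOutput n s)}

/-! ## Programs with bounded loops -/

/-! Both schemas come from one deterministic algorithm: exhaustive search over the `k`-subsets of a
kernel whose size depends only on `k` and `d = ε.den`. Since `ε * d ≥ 1` (`one_le_mul_den`), a
relative error of `1 / d` is enough. The program for minimization tosses no coin either, so it
succeeds with probability 1.

Call a vertex low if its degree is below `D = k²(d+1) + k + 1`. Balls along low vertices have at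
most `D ^ r` elements, and at most `|X| * D ^ r` of them meet a given set `X`. For each size `s ≤
k`, the kernel keeps the `M = 1 + k * D ^ k` balls with the best `s`-subsets. If a part of a
solution lies in a discarded ball, some kept ball avoids the rest of the solution and contains a
part of the same size that is at least as good (`exists_score_le_of_subset_lowBall`).

Throughout, the degree sum of a `k`-set exceeds its cut value by at most `k²`. For minimization the
radius is `k`. If every `k`-set has degree sum at least `k²(d+1)`, this excess is negligible and a
set of least degree sum is exchanged vertex by vertex. Otherwise the optimum is below `k²(d+1)`, so
all vertices of an optimal set are low; its components lie in balls and are exchanged one by one,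
cut values being subadditive (`exists_subset_kernel_min`).

For maximization the radius is 0, and layer 1 consists of the `M` vertices of largest degree. If a
vertex of degree at least `D` exists, the `k` largest degrees are nearly optimal. Otherwise every
vertex outside the layer can be replaced by one in the layer that is not adjacent to the rest of the
solution (`exists_subset_kernel_max`).

The remaining work implements the search. Programs with bounded loops have a total semantics
`BProg.run` and a step bound read off from weight, nesting depth and loop bounds
(`BProg.exists_exec`); `solve_run` and `program_exec` give correctness and running time. -/

/-- `s.setReg x v` writes `v` into register `x`. -/
def RState.setReg (s : RState) (x v : ℕ) : RState :=
  { s with reg := Function.update s.reg x v }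

/-- `s.setArr a i v` writes `v` into cell `i` of array `a`. -/
def RState.setArr (s : RState) (a i v : ℕ) : RState :=
  { s with arr := Function.update s.arr a (Function.update (s.arr a) i v) }

@[simp] theorem RState.setReg_reg (s : RState) (x v y : ℕ) :
    (s.setReg x v).reg y = if y = x then v else s.reg y := by
  simp [RState.setReg, Function.update_apply]

@[simp] theorem RState.setReg_arr (s : RState) (x v : ℕ) : (s.setReg x v).arr = s.arr := rfl

@[simp] theorem RState.setArr_reg (s : RState) (a i v : ℕ) : (s.setArr a i v).reg = s.reg := rfl

@[simp] theorem RState.setArr_arr (s : RState) (a i v b j : ℕ) :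
    (s.setArr a i v).arr b j = if b = a ∧ j = i then v else s.arr b j := by
  by_cases h : b = a
  · subst h; simp [RState.setArr, Function.update_apply]
  · simp [RState.setArr, h]

theorem RState.setArr_arr_of_ne (s : RState) {a b : ℕ} (i v : ℕ) (h : b ≠ a) :
    (s.setArr a i v).arr b = s.arr b := by
  simp [RState.setArr, h]

/-- Coin-free programs whose loops are all of the form `for x < r`: the value of register `r` on
entry is the number of rounds. -/
inductive BProg : Type
  | skip : BProg
  | assign (x : ℕ) (e : RExpr) : BProg
  | put (a : ℕ) (i e : RExpr) : BProg
  | seq (p q : BProg) : BProg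
  | cond (e : RExpr) (p q : BProg) : BProg
  | loop (x r : ℕ) (p : BProg) : BProg

/-- The configuration after `i` rounds of a loop with counter `x` and body `f`. -/
def loopState (f : RState → RState) (x : ℕ) (s : RState) : ℕ → RState
  | 0 => s.setReg x 0
  | i + 1 => (f (loopState f x s i)).setReg x (i + 1)

namespace BProg

/-- The configuration in which a program halts. -/
def run : BProg → RState → RState
  | skip => fun s => s
  | assign x e => fun s => s.setReg x (e.eval s)
  | put a i e => fun s => s.setArr a (i.eval s) (e.eval s)
  | seq p q => fun s => q.run (p.run s)
  | cond e p q => fun s => if e.eval s ≠ 0 then p.run s else q.run s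
  | loop x r p => fun s => loopState p.run x s (s.reg r)

@[simp] theorem run_skip (s : RState) : skip.run s = s := rfl

@[simp] theorem run_assign (x : ℕ) (e : RExpr) (s : RState) :
    (assign x e).run s = s.setReg x (e.eval s) := rfl

@[simp] theorem run_put (a : ℕ) (i e : RExpr) (s : RState) :
    (put a i e).run s = s.setArr a (i.eval s) (e.eval s) := rfl

@[simp] theorem run_seq (p q : BProg) (s : RState) : (seq p q).run s = q.run (p.run s) := rfl

theorem run_cond (e : RExpr) (p q : BProg) (s : RState) :
    (cond e p q).run s = if e.eval s ≠ 0 then p.run s else q.run s := rfl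

/-- The translation into programs of the machine. -/
def toRProg : BProg → RProg
  | skip => .skip
  | assign x e => .assign x e
  | put a i e => .put a i e
  | seq p q => .seq p.toRProg q.toRProg
  | cond e p q => .cond e p.toRProg q.toRProg
  | loop x r p => .seq (.assign x (.lit 0))
      (.loop (.sub (.reg r) (.reg x)) (.seq p.toRProg (.assign x (.add (.reg x) (.lit 1)))))

/-- The registers that a program may write. -/
def regs : BProg → List ℕ
  | skip => []
  | assign x _ => [x]
  | put _ _ _ => []
  | seq p q => p.regs ++ q.regs
  | cond _ p q => p.regs ++ q.regs
  | loop x _ p => x :: p.regs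

/-- The arrays that a program may write. -/
def arrs : BProg → List ℕ
  | skip => []
  | assign _ _ => []
  | put a _ _ => [a]
  | seq p q => p.arrs ++ q.arrs
  | cond _ p q => p.arrs ++ q.arrs
  | loop _ _ p => p.arrs

/-- The registers that bound the loops of a program. -/
def bounds : BProg → List ℕ
  | skip => []
  | assign _ _ => []
  | put _ _ _ => []
  | seq p q => p.bounds ++ q.bounds
  | cond _ p q => p.bounds ++ q.bounds
  | loop _ r p => r :: p.bounds

/-- No loop body writes the counter of its loop. -/
def CountersKept : BProg → Prop
  | skip => True
  | assign _ _ => True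
  | put _ _ _ => True
  | seq p q => p.CountersKept ∧ q.CountersKept
  | cond _ p q => p.CountersKept ∧ q.CountersKept
  | loop x _ p => x ∉ p.regs ∧ p.CountersKept

instance decidableCountersKept : (p : BProg) → Decidable p.CountersKept
  | skip => isTrue trivial
  | assign _ _ => isTrue trivial
  | put _ _ _ => isTrue trivial
  | seq p q => @instDecidableAnd _ _ (decidableCountersKept p) (decidableCountersKept q)
  | cond _ p q => @instDecidableAnd _ _ (decidableCountersKept p) (decidableCountersKept q)
  | loop _ _ p => @instDecidableAnd _ _ inferInstance (decidableCountersKept p)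

/-- The nesting depth of the loops. -/
def depth : BProg → ℕ
  | skip => 0
  | assign _ _ => 0
  | put _ _ _ => 0
  | seq p q => max p.depth q.depth
  | cond _ p q => max p.depth q.depth
  | loop _ _ p => p.depth + 1

/-- The number of steps of a program if the body of every loop is executed once, up to a constant
factor. -/
def weight : BProg → ℕ
  | skip => 1
  | assign _ e => e.cost + 1
  | put _ i e => i.cost + e.cost + 1
  | seq p q => p.weight + q.weight
  | cond e p q => e.cost + 1 + p.weight + q.weight
  | loop _ _ p => p.weight + 8

theorem toRProg_coinFree (p : BProg) : p.toRProg.CoinFree := by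
  induction p with
  | skip | assign | put => trivial
  | seq p q ihp ihq => exact ⟨ihp, ihq⟩
  | cond e p q ihp ihq => exact ⟨ihp, ihq⟩
  | loop x r p ih => exact ⟨trivial, ih, trivial⟩

/-! ### Frame conditions, the loop rule and running times -/

theorem loopState_reg {f : RState → RState} {x y : ℕ} (hy : y ≠ x)
    (hf : ∀ s, (f s).reg y = s.reg y) (s : RState) (i : ℕ) :
    (loopState f x s i).reg y = s.reg y := by
  induction i with
  | zero => simp [loopState, hy]
  | succ i ih => simp [loopState, hy, hf, ih]

theorem loopState_counter (f : RState → RState) (x : ℕ) (s : RState) (i : ℕ) :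
    (loopState f x s i).reg x = i := by
  cases i <;> simp [loopState]

theorem run_reg {p : BProg} {y : ℕ} (hy : y ∉ p.regs) (s : RState) :
    (p.run s).reg y = s.reg y := by
  induction p generalizing s with
  | skip => rfl
  | assign x e => simp_all [run, regs]
  | put a i e => simp [run]
  | seq p q ihp ihq => simp_all [run, regs]
  | cond e p q ihp ihq =>
    simp only [regs, List.mem_append, not_or] at hy
    simp only [run]
    split_ifs
    exacts [ihp hy.1 s, ihq hy.2 s]
  | loop x r p ih =>
    simp only [regs, List.mem_cons, not_or] at hy
    exact loopState_reg hy.1 (ih hy.2) s _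

theorem loopState_arr {f : RState → RState} {x a : ℕ}
    (hf : ∀ s, (f s).arr a = s.arr a) (s : RState) (i : ℕ) :
    (loopState f x s i).arr a = s.arr a := by
  induction i with
  | zero => simp [loopState]
  | succ i ih => simp [loopState, hf, ih]

theorem run_arr {p : BProg} {a : ℕ} (ha : a ∉ p.arrs) (s : RState) :
    (p.run s).arr a = s.arr a := by
  induction p generalizing s with
  | skip => rfl
  | assign x e => simp [run]
  | put b i e =>
    simp only [arrs, List.mem_singleton] at ha
    exact RState.setArr_arr_of_ne _ _ _ ha
  | seq p q ihp ihq => simp_all [run, arrs]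
  | cond e p q ihp ihq =>
    simp only [arrs, List.mem_append, not_or] at ha
    simp only [run]
    split_ifs
    exacts [ihp ha.1 s, ihq ha.2 s]
  | loop x r p ih => exact loopState_arr (ih ha) s _

/-- The rule for loops: an invariant, with everything that the loop does not write kept. -/
theorem run_loop {x r : ℕ} {p : BProg} {s : RState} (I : ℕ → RState → Prop)
    (zero : I 0 (s.setReg x 0))
    (succ : ∀ i < s.reg r, ∀ t : RState, I i t → t.reg x = i →
      (∀ y ∉ (loop x r p).regs, t.reg y = s.reg y) → (∀ a ∉ p.arrs, t.arr a = s.arr a) →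
      I (i + 1) ((p.run t).setReg x (i + 1))) :
    I (s.reg r) ((loop x r p).run s) := by
  have key : ∀ i ≤ s.reg r, I i (loopState p.run x s i) := by
    intro i
    induction i with
    | zero => exact fun _ => zero
    | succ i ih =>
      intro hi
      refine succ i hi _ (ih (by omega)) (loopState_counter _ _ _ _) (fun y hy => ?_) fun a ha => ?_
      · simp only [regs, List.mem_cons, not_or] at hy
        exact loopState_reg hy.1 (run_reg hy.2) s i
      · exact loopState_arr (run_arr ha) s i
  exact key _ le_rfl

/-- Induction on the number `i` of rounds still to come, since an execution of a loop is assembled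
from its end. A round costs 4 steps for the test and 4 for the increment besides the body; the
failing test costs the final 4. -/
theorem exists_loop_exec {x r : ℕ} {p : BProg} (hx : x ∉ p.regs) (hr : r ∉ (loop x r p).regs)
    {s : RState} {T : ℕ} (hp : ∀ i < s.reg r,
      ∃ t ≤ T, RExec p.toRProg (loopState p.run x s i) (p.run (loopState p.run x s i)) t)
    (i : ℕ) (hi : i ≤ s.reg r) :
    ∃ t ≤ i * (T + 8) + 4, RExec
      (.loop (.sub (.reg r) (.reg x)) (.seq p.toRProg (.assign x (.add (.reg x) (.lit 1)))))
      (loopState p.run x s (s.reg r - i)) (loopState p.run x s (s.reg r)) t := by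
  simp only [regs, List.mem_cons, not_or] at hr
  have hrr : ∀ j, (loopState p.run x s j).reg r = s.reg r :=
    loopState_reg hr.1 (run_reg hr.2) s
  induction i with
  | zero =>
    exact ⟨_, by simp [RExpr.cost], .loop_false (by simp [RExpr.eval, hrr, loopState_counter])⟩
  | succ i ih =>
    obtain ⟨t₂, ht₂, h₂⟩ := ih (by omega)
    obtain ⟨t₁, ht₁, h₁⟩ := hp (s.reg r - (i + 1)) (by omega)
    -- The machine increments the counter, whereas `loopState` overwrites it with the round number.
    -- These agree because the body keeps `x`.
    have hstep : RExec (.assign x (.add (.reg x) (.lit 1)))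
        (p.run (loopState p.run x s (s.reg r - (i + 1))))
        (loopState p.run x s (s.reg r - i)) 4 := by
      have : s.reg r - i = (s.reg r - (i + 1)) + 1 := by omega
      rw [this]
      have h := RExec.assign x (.add (.reg x) (.lit 1))
        (p.run (loopState p.run x s (s.reg r - (i + 1))))
      simpa [RExpr.eval, run_reg hx, loopState_counter, loopState, RState.setReg, RExpr.cost]
        using h
    refine ⟨_, ?_, .loop_true ?_ (.seq h₁ hstep) h₂⟩
    · simp only [RExpr.cost]
      linarith
    · simp only [RExpr.eval, hrr, loopState_counter]
      omega

/-- A program whose loop bounds are not written and do not exceed `B` halts within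
`weight * (B + 1) ^ depth` steps. -/
theorem exists_exec (p : BProg) (hp : p.CountersKept) (hb : ∀ r ∈ p.bounds, r ∉ p.regs)
    (s : RState) (B : ℕ) (hB : ∀ r ∈ p.bounds, s.reg r ≤ B) :
    ∃ t ≤ p.weight * (B + 1) ^ p.depth, RExec p.toRProg s (p.run s) t := by
  induction p generalizing s with
  | skip => exact ⟨1, by simp [weight, depth], .skip s⟩
  | assign x e => exact ⟨_, by simp [weight, depth], .assign x e s⟩
  | put a i e => exact ⟨_, by simp [weight, depth], .put a i e s⟩
  | seq p q ihp ihq =>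
    simp only [bounds, regs, List.mem_append, not_or] at hb hB
    obtain ⟨t₁, ht₁, h₁⟩ := ihp hp.1 (fun r hr => (hb r (.inl hr)).1) s fun r hr => hB r (.inl hr)
    obtain ⟨t₂, ht₂, h₂⟩ := ihq hp.2 (fun r hr => (hb r (.inr hr)).2) (p.run s) fun r hr => by
      rw [run_reg (hb r (.inr hr)).1]; exact hB r (.inr hr)
    refine ⟨_, ?_, .seq h₁ h₂⟩
    rw [weight, depth, add_mul]
    exact Nat.add_le_add
      (ht₁.trans (Nat.mul_le_mul_left _ (Nat.pow_le_pow_right (by omega) (le_max_left _ _))))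
      (ht₂.trans (Nat.mul_le_mul_left _ (Nat.pow_le_pow_right (by omega) (le_max_right _ _))))
  | cond e p q ihp ihq =>
    simp only [bounds, regs, List.mem_append, not_or] at hb hB
    obtain ⟨t₁, ht₁, h₁⟩ := ihp hp.1 (fun r hr => (hb r (.inl hr)).1) s fun r hr => hB r (.inl hr)
    obtain ⟨t₂, ht₂, h₂⟩ := ihq hp.2 (fun r hr => (hb r (.inr hr)).2) s fun r hr => hB r (.inr hr)
    replace ht₁ := ht₁.trans (Nat.mul_le_mul_left p.weight
      (Nat.pow_le_pow_right (n := B + 1) (by omega) (le_max_left p.depth q.depth)))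
    replace ht₂ := ht₂.trans (Nat.mul_le_mul_left q.weight
      (Nat.pow_le_pow_right (n := B + 1) (by omega) (le_max_right p.depth q.depth)))
    have h1 : 1 ≤ (B + 1) ^ max p.depth q.depth := Nat.one_le_pow _ _ (by omega)
    have h2 : e.cost + 1 ≤ (e.cost + 1) * (B + 1) ^ max p.depth q.depth :=
      Nat.le_mul_of_pos_right _ h1
    simp only [weight, depth, add_mul (e.cost + 1 + _), add_mul (e.cost + 1)]
    by_cases he : e.eval s ≠ 0
    · refine ⟨e.cost + 1 + t₁, by omega, ?_⟩
      rw [run_cond, if_pos he]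
      exact .cond_true he h₁
    · refine ⟨e.cost + 1 + t₂, by omega, ?_⟩
      rw [run_cond, if_neg he]
      exact .cond_false (not_not.1 he) h₂
  | loop x r p ih =>
    have hr : r ∉ (loop x r p).regs := hb r (by simp [bounds])
    have hin : ∀ i, ∃ t ≤ p.weight * (B + 1) ^ p.depth,
        RExec p.toRProg (loopState p.run x s i) (p.run (loopState p.run x s i)) t := by
      intro i
      have hb' : ∀ y ∈ p.bounds, y ≠ x ∧ y ∉ p.regs := fun y hy => by
        simpa [regs] using hb y (by simp [bounds, hy])
      refine ih hp.2 (fun y hy => (hb' y hy).2) _ fun y hy => ?_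
      rw [loopState_reg (hb' y hy).1 (run_reg (hb' y hy).2)]
      exact hB y (by simp [bounds, hy])
    obtain ⟨t, ht, h⟩ := exists_loop_exec hp.1 hr (fun i _ => hin i) (s.reg r) le_rfl
    rw [Nat.sub_self] at h
    refine ⟨_, ?_, .seq (.assign x (.lit 0) s) h⟩
    have hBr : s.reg r ≤ B := hB r (by simp [bounds])
    have h1 : 1 ≤ (B + 1) ^ p.depth := Nat.one_le_pow _ _ (by omega)
    simp only [weight, depth, RExpr.cost, pow_succ]
    generalize (B + 1) ^ p.depth = N at *
    -- Two steps initialize the counter, at most `B` rounds follow, and the failing test takes 4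
    -- steps.
    calc 1 + 1 + t ≤ 2 + (B * (p.weight * N + 8) + 4) := by
          have := Nat.mul_le_mul_right (p.weight * N + 8) hBr
          omega
      _ ≤ (p.weight + 8) * (N * (B + 1)) := by
          have h2 : B ≤ B * N := Nat.le_mul_of_pos_right _ h1
          have h3 : 0 ≤ p.weight * N := Nat.zero_le _
          nlinarith

end BProg

/-! ## A small set of vertices that holds a nearly optimal solution -/

section Kernel

variable {n : ℕ} (G : SimpleGraph (Fin n))

open Classical in
/-- The number of neighbours of a vertex. -/
noncomputable def nbrCount (v : Fin n) : ℕ :=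
  (Finset.univ.filter fun u => G.Adj v u).card

/-- The objective as a quantity that is to be maximized and is always positive. -/
noncomputable def score : CutGoal → Finset (Fin n) → ℕ
  | .max, S => 1 + cutValue G S
  | .min, S => 1 + (n * n - cutValue G S)

/-- The largest score of a subset of `X` with `s` elements, 0 if there is none. -/
noncomputable def bestScore (goal : CutGoal) (X : Finset (Fin n)) (s : ℕ) : ℕ :=
  (X.powersetCard s).sup (score G goal)

open Classical in
/-- Add to `X` the neighbours along edges between vertices of degree less than `D`. -/
noncomputable def lowStep (D : ℕ) (X : Finset (Fin n)) : Finset (Fin n) :=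
  Finset.univ.filter fun w =>
    w ∈ X ∨ (nbrCount G w < D ∧ ∃ u ∈ X, nbrCount G u < D ∧ G.Adj w u)

/-- The vertices at distance at most `r` from `v` along vertices of degree less than `D`. -/
noncomputable def lowBall (D r : ℕ) (v : Fin n) : Finset (Fin n) :=
  (lowStep G D)^[r] {v}

/-- The number of vertices that precede `v` when the vertices are sorted by decreasing `key`. -/
def keyRank (key : Fin n → ℕ) (v : Fin n) : ℕ :=
  (Finset.univ.filter fun u => key v < key u + if u < v then 1 else 0).card

/-- The first `M` vertices when the vertices are sorted by decreasing `key`. -/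
def topRanked (key : Fin n → ℕ) (M : ℕ) : Finset (Fin n) :=
  Finset.univ.filter fun v => keyRank key v < M

/-- The union of the balls of radius `r` around the `M` vertices whose balls contain the best sets
of `s` vertices. -/
noncomputable def kernelLayer (goal : CutGoal) (D r M s : ℕ) : Finset (Fin n) :=
  (topRanked (fun v => bestScore G goal (lowBall G D r v) s) M).biUnion (lowBall G D r)

/-- The union of the layers for all sizes `s ≤ k`. -/
noncomputable def kernel (goal : CutGoal) (D r M k : ℕ) : Finset (Fin n) :=
  (Finset.range (k + 1)).biUnion (kernelLayer G goal D r M)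

variable {G}

/-! ### Cut values -/

open Classical in
theorem cutValue_eq_card (S : Finset (Fin n)) :
    cutValue G S = (Finset.univ.filter fun p : Fin n × Fin n =>
      p.1 ∈ S ∧ p.2 ∉ S ∧ G.Adj p.1 p.2).card := by
  unfold cutValue
  congr 1
  ext ⟨u, v⟩
  simp [SimpleGraph.mem_interedges_iff]

theorem cutValue_le_sq (S : Finset (Fin n)) : cutValue G S ≤ n * n := by
  classical
  rw [cutValue_eq_card]
  exact (Finset.card_le_univ _).trans (by simp)

theorem cutValue_union_le (A B : Finset (Fin n)) :
    cutValue G (A ∪ B) ≤ cutValue G A + cutValue G B := by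
  classical
  simp only [cutValue_eq_card]
  refine le_trans (Finset.card_le_card ?_) (Finset.card_union_le _ _)
  intro p
  simp only [Finset.mem_filter, Finset.mem_univ, true_and, Finset.mem_union]
  tauto

/-- Without edges between the parts, an edge leaving one part also leaves the union. -/
theorem add_le_cutValue_union {A B : Finset (Fin n)} (hAB : Disjoint A B)
    (h : ∀ a ∈ A, ∀ b ∈ B, ¬ G.Adj a b) :
    cutValue G A + cutValue G B ≤ cutValue G (A ∪ B) := by
  classical
  simp only [cutValue_eq_card]
  rw [← Finset.card_union_of_disjoint]
  · refine Finset.card_le_card fun p => ?_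
    simp only [Finset.mem_filter, Finset.mem_univ, true_and, Finset.mem_union]
    rintro (⟨h1, h2, h3⟩ | ⟨h1, h2, h3⟩)
    · exact ⟨.inl h1, fun h' => h'.elim h2 fun hB => h _ h1 _ hB h3, h3⟩
    · exact ⟨.inr h1, fun h' => h'.elim (fun hA => h _ hA _ h1 h3.symm) h2, h3⟩
  · rw [Finset.disjoint_left] at hAB ⊢
    intro p
    simp only [Finset.mem_filter, Finset.mem_univ, true_and]
    exact fun h1 h2 => hAB h1.1 h2.1

theorem cutValue_singleton (v : Fin n) : cutValue G {v} = nbrCount G v := by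
  classical
  rw [cutValue_eq_card, nbrCount]
  refine Finset.card_bij' (fun p _ => p.2) (fun u _ => (v, u)) ?_ ?_ ?_ ?_
  · rintro ⟨a, b⟩ h
    simp only [Finset.mem_filter, Finset.mem_univ, true_and, Finset.mem_singleton] at h ⊢
    exact h.1 ▸ h.2.2
  · intro u h
    simp only [Finset.mem_filter, Finset.mem_univ, true_and, Finset.mem_singleton] at h ⊢
    exact ⟨h.ne', h⟩
  · rintro ⟨a, b⟩ h
    simp only [Finset.mem_filter, Finset.mem_univ, true_and, Finset.mem_singleton] at h ⊢
    rw [h.1]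
  · simp

open Classical in
theorem sum_nbrCount_eq_card (S : Finset (Fin n)) :
    ∑ v ∈ S, nbrCount G v = (Finset.univ.filter fun p : Fin n × Fin n =>
      p.1 ∈ S ∧ G.Adj p.1 p.2).card := by
  have : (Finset.univ.filter fun p : Fin n × Fin n => p.1 ∈ S ∧ G.Adj p.1 p.2) =
      (S ×ˢ Finset.univ).filter fun p : Fin n × Fin n => G.Adj p.1 p.2 := by
    ext p; simp
  rw [this, Finset.card_filter, Finset.sum_product]
  simp [nbrCount]

theorem cutValue_le_sum (S : Finset (Fin n)) : cutValue G S ≤ ∑ v ∈ S, nbrCount G v := by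
  classical
  rw [cutValue_eq_card, sum_nbrCount_eq_card]
  refine Finset.card_le_card fun p => ?_
  simp only [Finset.mem_filter, Finset.mem_univ, true_and]
  tauto

/-- The degree sum counts ordered adjacent pairs with first entry in `S`; those that do not cross
the cut lie in `S ×ˢ S`. -/
theorem sum_le_cutValue_add (S : Finset (Fin n)) :
    ∑ v ∈ S, nbrCount G v ≤ cutValue G S + S.card ^ 2 := by
  classical
  rw [cutValue_eq_card, sum_nbrCount_eq_card, sq, ← Finset.card_product]
  refine le_trans (Finset.card_le_card ?_) (Finset.card_union_le _ _)
  intro p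
  simp only [Finset.mem_filter, Finset.mem_univ, true_and, Finset.mem_union, Finset.mem_product]
  tauto

/-- Neighbours outside `S` give distinct cut edges, and at most `S.card` neighbours lie inside. This
makes all vertices of a set with a small cut low. -/
theorem nbrCount_le_cutValue_add {S : Finset (Fin n)} {v : Fin n} (hv : v ∈ S) :
    nbrCount G v ≤ cutValue G S + S.card := by
  classical
  have h : (Finset.univ.filter fun u => G.Adj v u) ⊆
      ((Finset.univ.filter fun p : Fin n × Fin n =>
        p.1 ∈ S ∧ p.2 ∉ S ∧ G.Adj p.1 p.2).image Prod.snd) ∪ S := by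
    intro u
    simp only [Finset.mem_filter, Finset.mem_univ, true_and, Finset.mem_union, Finset.mem_image,
      Prod.exists, exists_eq_right]
    intro hu
    by_cases huS : u ∈ S
    · exact .inr huS
    · exact .inl ⟨v, hv, huS, hu⟩
  rw [cutValue_eq_card, nbrCount]
  exact (Finset.card_le_card h).trans ((Finset.card_union_le _ _).trans
    (Nat.add_le_add_right Finset.card_image_le _))

theorem score_pos (goal : CutGoal) (S : Finset (Fin n)) : 0 < score G goal S := by
  cases goal <;> simp [score]

theorem score_max_le_iff {A B : Finset (Fin n)} :
    score G .max A ≤ score G .max B ↔ cutValue G A ≤ cutValue G B := by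
  simp [score]

/-- Truncated subtraction loses nothing here, because cut values are at most `n * n`. -/
theorem score_min_le_iff {A B : Finset (Fin n)} :
    score G .min A ≤ score G .min B ↔ cutValue G B ≤ cutValue G A := by
  have := cutValue_le_sq (G := G) A
  have := cutValue_le_sq (G := G) B
  simp only [score]
  omega

theorem score_le_bestScore {goal : CutGoal} {X A : Finset (Fin n)} (h : A ⊆ X) :
    score G goal A ≤ bestScore G goal X A.card :=
  Finset.le_sup (f := score G goal) (Finset.mem_powersetCard.2 ⟨h, rfl⟩)

/-- Scores are positive, so the value 0 is reserved for the case that no subset has the required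
size. -/
theorem exists_of_bestScore_pos {goal : CutGoal} {X : Finset (Fin n)} {s : ℕ}
    (h : 0 < bestScore G goal X s) :
    ∃ A ⊆ X, A.card = s ∧ score G goal A = bestScore G goal X s := by
  have hne : (X.powersetCard s).Nonempty := by
    rw [Finset.nonempty_iff_ne_empty]
    intro h0
    simp [bestScore, h0] at h
  obtain ⟨A, hA, hAs⟩ := Finset.exists_mem_eq_sup _ hne (score G goal)
  rw [Finset.mem_powersetCard] at hA
  exact ⟨A, hA.1, hA.2, hAs.symm⟩

/-! ### Sorting -/

/-- The order is lexicographic, with ties broken by the smaller index. By transitivity whatever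
precedes `u` precedes `v`, and `u` precedes `v` but not itself. -/
theorem keyRank_lt_keyRank {key : Fin n → ℕ} {u v : Fin n}
    (h : key v < key u + if u < v then 1 else 0) : keyRank key u < keyRank key v := by
  refine Finset.card_lt_card (Finset.ssubset_iff_of_subset (fun w hw => ?_) |>.2 ⟨u, ?_, ?_⟩)
  · simp only [Finset.mem_filter, Finset.mem_univ, true_and] at hw ⊢
    split_ifs at * <;> omega
  · simpa using h
  · simp

theorem keyRank_injective (key : Fin n → ℕ) : Function.Injective (keyRank key) := by
  intro u v huv
  by_contra hne
  have : (key v < key u + if u < v then 1 else 0) ∨ (key u < key v + if v < u then 1 else 0) := by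
    split_ifs <;> omega
  rcases this with h | h
  · exact (keyRank_lt_keyRank h).ne huv
  · exact (keyRank_lt_keyRank h).ne' huv

theorem keyRank_lt (key : Fin n → ℕ) (v : Fin n) : keyRank key v < n := by
  refine lt_of_lt_of_eq (Finset.card_lt_univ_of_notMem (x := v) ?_) (Fintype.card_fin n)
  simp

theorem card_topRanked_le (key : Fin n → ℕ) (M : ℕ) : (topRanked key M).card ≤ M := by
  refine (Finset.card_le_card_of_injOn (keyRank key) (t := Finset.range M) (fun v hv => ?_)
    (keyRank_injective key).injOn).trans (Finset.card_range M).le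
  simpa [topRanked] using hv

/-- Ranks are injective into the numbers below `n`, hence a permutation of them. -/
theorem le_card_topRanked {key : Fin n → ℕ} {M : ℕ} (h : M ≤ n) :
    M ≤ (topRanked key M).card := by
  let f : Fin n → Fin n := fun v => ⟨keyRank key v, keyRank_lt key v⟩
  have hf : Function.Surjective f := Finite.injective_iff_surjective.1 fun u v huv =>
    keyRank_injective key (congrArg Fin.val huv)
  refine (Finset.card_range M).symm.le.trans
    (Finset.card_le_card_of_surjOn (keyRank key) fun i hi => ?_)
  rw [Finset.mem_coe, Finset.mem_range] at hi
  obtain ⟨v, hv⟩ := hf ⟨i, by omega⟩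
  have hv' : keyRank key v = i := congrArg Fin.val hv
  exact ⟨v, by simpa [topRanked, hv'] using hi, hv'⟩

theorem le_card_topRanked_of_notMem {key : Fin n → ℕ} {M : ℕ} {v : Fin n}
    (hv : v ∉ topRanked key M) : M ≤ (topRanked key M).card := by
  have : M ≤ keyRank key v := by simpa [topRanked] using hv
  exact le_card_topRanked (this.trans (keyRank_lt key v).le)

theorem key_le_of_notMem_topRanked {key : Fin n → ℕ} {M : ℕ} {v w : Fin n}
    (hv : v ∉ topRanked key M) (hw : w ∈ topRanked key M) : key v ≤ key w := by
  simp only [topRanked, Finset.mem_filter, Finset.mem_univ, true_and] at hv hw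
  by_contra! h
  have := keyRank_lt_keyRank (key := key) (u := v) (v := w) (by omega)
  omega

theorem topRanked_mono {key : Fin n → ℕ} {M N : ℕ} (h : M ≤ N) :
    topRanked key M ⊆ topRanked key N := by
  intro v hv
  simp only [topRanked, Finset.mem_filter, Finset.mem_univ, true_and] at hv ⊢
  omega

/-! ### Balls -/

theorem mem_lowStep {D : ℕ} {X : Finset (Fin n)} {w : Fin n} :
    w ∈ lowStep G D X ↔
      w ∈ X ∨ (nbrCount G w < D ∧ ∃ u ∈ X, nbrCount G u < D ∧ G.Adj w u) := by
  simp [lowStep]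

/-- A low vertex contributes itself and at most `D - 1` neighbours. Any other vertex contributes
only itself, which needs `0 < D`. -/
theorem card_lowStep_le {D : ℕ} (hD : 0 < D) (X : Finset (Fin n)) :
    (lowStep G D X).card ≤ X.card * D := by
  classical
  have h : lowStep G D X ⊆ X.biUnion fun u =>
      insert u (Finset.univ.filter fun w => nbrCount G u < D ∧ G.Adj u w) := by
    intro w hw
    simp only [mem_lowStep, Finset.mem_biUnion, Finset.mem_insert, Finset.mem_filter,
      Finset.mem_univ, true_and] at hw ⊢
    rcases hw with hw | ⟨_, u, hu, hu', huw⟩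
    · exact ⟨w, hw, .inl rfl⟩
    · exact ⟨u, hu, .inr ⟨hu', huw.symm⟩⟩
  refine (Finset.card_le_card h).trans (Finset.card_biUnion_le_card_mul _ _ _ fun u _ => ?_)
  refine (Finset.card_insert_le _ _).trans ?_
  by_cases hu : nbrCount G u < D
  · simp only [hu, true_and]
    exact hu
  · simp only [hu, false_and, Finset.filter_false, Finset.card_empty]
    exact hD

theorem card_iterate_lowStep_le {D : ℕ} (hD : 0 < D) (r : ℕ) (X : Finset (Fin n)) :
    ((lowStep G D)^[r] X).card ≤ X.card * D ^ r := by
  induction r with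
  | zero => simp
  | succ r ih =>
    rw [Function.iterate_succ_apply', pow_succ, ← mul_assoc]
    exact (card_lowStep_le hD _).trans (Nat.mul_le_mul_right _ ih)

theorem card_lowBall_le {D : ℕ} (hD : 0 < D) (r : ℕ) (v : Fin n) :
    (lowBall G D r v).card ≤ D ^ r := by
  simpa [lowBall] using card_iterate_lowStep_le (G := G) hD r {v}

/-- Both ends of a usable edge must be low, so the step relation is symmetric. -/
theorem lowStep_disjoint_iff {D : ℕ} {X Y : Finset (Fin n)} :
    Disjoint (lowStep G D X) Y ↔ Disjoint X (lowStep G D Y) := by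
  simp only [Finset.disjoint_left, mem_lowStep]
  constructor
  · intro h a haX ha
    rcases ha with ha | ⟨h1, u, hu, h2, h3⟩
    · exact h (.inl haX) ha
    · exact h (.inr ⟨h2, a, haX, h1, h3.symm⟩) hu
  · intro h a ha haY
    rcases ha with ha | ⟨h1, u, hu, h2, h3⟩
    · exact h ha (.inl haY)
    · exact h hu (.inr ⟨h2, a, haY, h1, h3.symm⟩)

theorem iterate_lowStep_disjoint_iff {D r : ℕ} {X Y : Finset (Fin n)} :
    Disjoint ((lowStep G D)^[r] X) Y ↔ Disjoint X ((lowStep G D)^[r] Y) := by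
  induction r generalizing X Y with
  | zero => rfl
  | succ r ih =>
    rw [Function.iterate_succ_apply, ih, lowStep_disjoint_iff, Function.iterate_succ_apply']

/-- By symmetry the ball around `v` meets `X` exactly when `v` lies in the ball around `X`, and that
ball has a bounded size. -/
theorem card_not_disjoint_lowBall_le {D : ℕ} (hD : 0 < D) (r : ℕ) (X : Finset (Fin n)) :
    (Finset.univ.filter fun v => ¬ Disjoint (lowBall G D r v) X).card ≤ X.card * D ^ r := by
  refine (Finset.card_le_card fun v hv => ?_).trans (card_iterate_lowStep_le (G := G) hD r X)
  rw [Finset.mem_filter, lowBall, iterate_lowStep_disjoint_iff] at hv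
  simpa using hv.2

theorem iterate_lowStep_mono {D : ℕ} (X : Finset (Fin n)) :
    Monotone fun r => (lowStep G D)^[r] X := by
  refine monotone_nat_of_le_succ fun r => ?_
  rw [Function.iterate_succ_apply']
  exact fun w hw => mem_lowStep.2 (.inl hw)

theorem mem_lowBall_self {D r : ℕ} (v : Fin n) : v ∈ lowBall G D r v :=
  iterate_lowStep_mono (G := G) (D := D) {v} (Nat.zero_le r) (by simp)

/-! ### The kernel -/

theorem card_kernel_le {goal : CutGoal} {D : ℕ} (hD : 0 < D) (r M k : ℕ) :
    (kernel G goal D r M k).card ≤ (k + 1) * (M * D ^ r) := by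
  refine (Finset.card_biUnion_le_card_mul _ _ _ fun s _ => ?_).trans (by rw [Finset.card_range])
  exact (Finset.card_biUnion_le_card_mul _ _ _ fun v _ => card_lowBall_le hD r v).trans
    (Nat.mul_le_mul_right _ (card_topRanked_le _ _))

theorem kernelLayer_subset_kernel {goal : CutGoal} {D r M k s : ℕ} (h : s ≤ k) :
    kernelLayer G goal D r M s ⊆ kernel G goal D r M k :=
  Finset.subset_biUnion_of_mem (kernelLayer G goal D r M) (Finset.mem_range.2 (by omega))

theorem lowBall_subset_kernelLayer {goal : CutGoal} {D r M s : ℕ} {v : Fin n}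
    (h : v ∈ topRanked (fun v => bestScore G goal (lowBall G D r v) s) M) :
    lowBall G D r v ⊆ kernelLayer G goal D r M s :=
  Finset.subset_biUnion_of_mem (lowBall G D r) h

/-- A set inside a ball can be exchanged for a set in the kernel that avoids `X` and is at least as
good. -/
theorem exists_score_le_of_subset_lowBall {goal : CutGoal} {D r M : ℕ} (hD : 0 < D)
    {X C : Finset (Fin n)} {v : Fin n} (hC : C ⊆ lowBall G D r v) (hCX : Disjoint C X)
    (hM : X.card * D ^ r < M) :
    ∃ A ⊆ kernelLayer G goal D r M C.card, A.card = C.card ∧ Disjoint A X ∧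
      score G goal C ≤ score G goal A := by
  set key : Fin n → ℕ := fun v => bestScore G goal (lowBall G D r v) C.card with hkey
  by_cases hv : v ∈ topRanked key M
  · exact ⟨C, hC.trans (lowBall_subset_kernelLayer hv), rfl, hCX, le_rfl⟩
  -- Pigeonhole: `M` balls were kept, and fewer than `M` balls can meet `X`.
  obtain ⟨w, hw, hwX⟩ : ∃ w ∈ topRanked key M, Disjoint (lowBall G D r w) X := by
    by_contra! h
    have h1 : (topRanked key M).card ≤ X.card * D ^ r :=
      (Finset.card_le_card fun w hw => by simpa using h w hw).trans
        (card_not_disjoint_lowBall_le (G := G) hD r X)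
    have := le_card_topRanked_of_notMem hv
    omega
  have h1 : score G goal C ≤ key w :=
    (score_le_bestScore hC).trans (key_le_of_notMem_topRanked hv hw)
  obtain ⟨A, hA, hAc, hAs⟩ := exists_of_bestScore_pos ((score_pos goal C).trans_le h1)
  exact ⟨A, hA.trans (lowBall_subset_kernelLayer hw), hAc,
    Finset.disjoint_of_subset_left hA hwX, hAs ▸ h1⟩

/-! ### Minimization -/

/-- If `S` can be taken apart into pieces inside balls, with total cut value at most `φ S`, then
the kernel holds a set of the same size with cut value at most `φ S`. -/
theorem exists_subset_kernel_cutValue_le {D r M k : ℕ} (hD : 0 < D) {S : Finset (Fin n)}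
    (hS : S.card ≤ k) (hM : k * D ^ r < M) (φ : Finset (Fin n) → ℕ)
    (hφ : ∀ R ⊆ S, R.Nonempty → ∃ C ⊆ R, C.Nonempty ∧ (∃ v, C ⊆ lowBall G D r v) ∧
      cutValue G C + φ (R \ C) ≤ φ R) :
    ∃ Z ⊆ kernel G .min D r M k, Z.card = S.card ∧ cutValue G Z ≤ φ S := by
  -- Generalized for the induction: `Y` is the part already moved into the kernel, `R` the part of
  -- `S` still to be moved.
  have key : ∀ m, ∀ R ⊆ S, R.card = m → ∀ Y ⊆ kernel G .min D r M k, Disjoint Y R →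
      Y.card + R.card ≤ k → ∃ Z ⊆ kernel G .min D r M k, Z.card = Y.card + R.card ∧
        cutValue G Z ≤ cutValue G Y + φ R := by
    intro m
    induction m using Nat.strong_induction_on with
    | _ m ih =>
      intro R hR hm Y hY hYR hk
      rcases R.eq_empty_or_nonempty with rfl | hne
      · exact ⟨Y, hY, by simp, by omega⟩
      obtain ⟨C, hCR, hCne, ⟨v, hCv⟩, hCφ⟩ := hφ R hR hne
      have hcard := Finset.card_sdiff_add_card_eq_card hCR
      have hCpos := hCne.card_pos
      have hX : (Y ∪ R \ C).card * D ^ r < M := by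
        refine lt_of_le_of_lt (Nat.mul_le_mul_right _ ?_) hM
        refine (Finset.card_union_le _ _).trans ?_
        omega
      have hCX : Disjoint C (Y ∪ R \ C) := by
        rw [Finset.disjoint_union_right]
        exact ⟨Finset.disjoint_of_subset_left hCR hYR.symm, Finset.disjoint_sdiff⟩
      obtain ⟨A, hAK, hAc, hAX, hAs⟩ :=
        exists_score_le_of_subset_lowBall (goal := .min) hD hCv hCX hX
      rw [Finset.disjoint_union_right] at hAX
      have hYA : (Y ∪ A).card = Y.card + A.card := Finset.card_union_of_disjoint hAX.1.symm
      obtain ⟨Z, hZ, hZc, hZv⟩ := ih (R \ C).card (by omega) (R \ C)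
        (Finset.sdiff_subset.trans hR) rfl (Y ∪ A)
        (Finset.union_subset hY (hAK.trans (kernelLayer_subset_kernel (by omega))))
        (by
          rw [Finset.disjoint_union_left]
          exact ⟨Finset.disjoint_of_subset_right Finset.sdiff_subset hYR, hAX.2⟩)
        (by omega)
      refine ⟨Z, hZ, by omega, ?_⟩
      -- Subadditivity suffices, so edges between `Y` and `A` do no harm when minimizing.
      have h1 := cutValue_union_le (G := G) Y A
      rw [score_min_le_iff] at hAs
      omega
  obtain ⟨Z, hZ, hZc, hZv⟩ := key _ S le_rfl rfl ∅ (by simp) (by simp) (by simpa using hS)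
  refine ⟨Z, hZ, by simpa using hZc, ?_⟩
  have h0 : cutValue G (∅ : Finset (Fin n)) = 0 := by
    simpa using cutValue_le_sum (G := G) (∅ : Finset (Fin n))
  omega

/-- A set of low-degree vertices has a part, inside a ball, that no edge leaves within the set. -/
theorem exists_component {D k : ℕ} {R : Finset (Fin n)} (hR : R.Nonempty) (hk : R.card ≤ k)
    (hlow : ∀ v ∈ R, nbrCount G v < D) :
    ∃ C ⊆ R, C.Nonempty ∧ (∃ v, C ⊆ lowBall G D k v) ∧
      cutValue G C + cutValue G (R \ C) ≤ cutValue G R := by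
  classical
  obtain ⟨v, hv⟩ := hR
  -- A largest member of `F` plays the role of the component of `v`. Tying the radius to the
  -- cardinality lets a set grow by an adjacent vertex and stay in `F`.
  set F := R.powerset.filter fun C => v ∈ C ∧ C ⊆ lowBall G D C.card v with hF
  have hvF : {v} ∈ F := by
    simp only [hF, Finset.mem_filter, Finset.mem_powerset, Finset.singleton_subset_iff]
    exact ⟨hv, by simp, mem_lowBall_self v⟩
  obtain ⟨C, hC, hmax⟩ := Finset.exists_max_image F Finset.card ⟨_, hvF⟩
  simp only [hF, Finset.mem_filter, Finset.mem_powerset] at hC hmax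
  obtain ⟨hCR, hvC, hCb⟩ := hC
  refine ⟨C, hCR, ⟨v, hvC⟩, ⟨v, hCb.trans
    (iterate_lowStep_mono (G := G) {v} ((Finset.card_le_card hCR).trans hk))⟩, ?_⟩
  have h := add_le_cutValue_union (G := G) (A := C) (B := R \ C) Finset.disjoint_sdiff ?_
  · rwa [Finset.union_sdiff_of_subset hCR] at h
  intro a ha b hb hab
  rw [Finset.mem_sdiff] at hb
  have := hmax (insert b C) ⟨Finset.insert_subset hb.1 hCR, by simp [hvC], ?_⟩
  · rw [Finset.card_insert_of_notMem hb.2] at this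
    omega
  · rw [Finset.card_insert_of_notMem hb.2]
    refine Finset.insert_subset ?_ (hCb.trans (iterate_lowStep_mono (G := G) {v} (Nat.le_succ _)))
    rw [lowBall, Function.iterate_succ_apply']
    exact mem_lowStep.2 (.inr ⟨hlow b hb.1, a, hCb ha, hlow a (hCR ha), hab.symm⟩)

/-- The potential `φ` passed to `exists_subset_kernel_cutValue_le` depends on the least degree sum
of a `k`-set: if it is large, `φ` is the degree sum and the pieces are single vertices; if it is
small, `φ` is the cut value and the pieces are components of an optimal set. -/
theorem exists_subset_kernel_min {D M k d : ℕ} (hk : k ≤ n) (hD : k ^ 2 * (d + 1) + k < D)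
    (hM : k * D ^ k < M) :
    ∃ Z ⊆ kernel G .min D k M k, Z.card = k ∧
      ∀ W : Finset (Fin n), W.card = k → d * cutValue G Z ≤ (d + 1) * cutValue G W := by
  have hne : (Finset.univ.powersetCard k : Finset (Finset (Fin n))).Nonempty :=
    Finset.powersetCard_nonempty.2 (by simpa using hk)
  obtain ⟨L, hL, hLmin⟩ := Finset.exists_min_image _ (fun S => ∑ v ∈ S, nbrCount G v) hne
  obtain ⟨O, hO, hOmin⟩ := Finset.exists_min_image _ (cutValue G) hne
  simp only [Finset.mem_powersetCard, Finset.subset_univ, true_and] at hL hLmin hO hOmin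
  by_cases h : k ^ 2 * (d + 1) ≤ ∑ v ∈ L, nbrCount G v
  · obtain ⟨Z, hZ, hZc, hZv⟩ := exists_subset_kernel_cutValue_le (G := G) (r := k) (by omega) hL.le hM
      (fun R => ∑ v ∈ R, nbrCount G v) fun R _ ⟨v, hv⟩ => by
        refine ⟨{v}, by simpa using hv, by simp, ⟨v, by simpa using mem_lowBall_self v⟩, ?_⟩
        rw [cutValue_singleton, add_comm]
        simpa using (Finset.sum_sdiff (f := nbrCount G) (Finset.singleton_subset_iff.2 hv)).le
    refine ⟨Z, hZ, hZc.trans hL, fun W hW => ?_⟩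
    have h1 := hLmin W hW
    have h2 := sum_le_cutValue_add (G := G) W
    rw [hW] at h2
    generalize ∑ v ∈ L, nbrCount G v = x at *
    -- From `k²(d+1) ≤ x ≤ cutValue G W + k²` follows `d * k² ≤ cutValue G W`, hence `d * x ≤ (d+1)
    -- * cutValue G W`.
    nlinarith
  · have hOL : cutValue G O < k ^ 2 * (d + 1) :=
      (hOmin L hL).trans_lt ((cutValue_le_sum L).trans_lt (not_le.1 h))
    obtain ⟨Z, hZ, hZc, hZv⟩ := exists_subset_kernel_cutValue_le (G := G) (r := k) (by omega) hO.le hM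
      (cutValue G) fun R hR hRne => by
        refine exists_component hRne ((Finset.card_le_card hR).trans hO.le) fun v hv => ?_
        have := nbrCount_le_cutValue_add (G := G) (hR hv)
        omega
    refine ⟨Z, hZ, hZc.trans hO, fun W hW => ?_⟩
    have := hOmin W hW
    nlinarith

/-! ### Maximization -/

/-- After cancelling the common part, the largest value on `W \ Z` separates the two sums, which
have equally many terms. -/
theorem sum_le_sum_of_forall_le {f : Fin n → ℕ} {Z W : Finset (Fin n)} (hc : W.card = Z.card)
    (h : ∀ z ∈ Z, ∀ w ∉ Z, f w ≤ f z) : ∑ v ∈ W, f v ≤ ∑ v ∈ Z, f v := by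
  rw [← Finset.sum_inter_add_sum_sdiff W Z f, ← Finset.sum_inter_add_sum_sdiff Z W f,
    Finset.inter_comm]
  refine Nat.add_le_add_left ?_ _
  refine (Finset.sum_le_card_nsmul _ _ ((W \ Z).sup f) fun w hw => Finset.le_sup hw).trans ?_
  rw [Finset.card_sdiff_comm hc]
  refine Finset.card_nsmul_le_sum _ _ _ fun z hz => Finset.sup_le fun w hw => ?_
  rw [Finset.mem_sdiff] at hz hw
  exact h z hz.1 w hw.2

/-- If all degrees are low, then every set can be moved into the kernel. -/
theorem exists_subset_kernelLayer_le_cutValue {D M : ℕ} (hlow : ∀ v, nbrCount G v < D)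
    (W : Finset (Fin n)) (hM : W.card * D < M) :
    ∃ Z ⊆ kernelLayer G .max D 0 M 1, Z.card = W.card ∧ cutValue G W ≤ cutValue G Z := by
  classical
  induction hm : (W \ kernelLayer G .max D 0 M 1).card using Nat.strong_induction_on
    generalizing W with
  | _ m ih =>
    by_cases hW : W ⊆ kernelLayer G .max D 0 M 1
    · exact ⟨W, hW, rfl, le_rfl⟩
    obtain ⟨v, hvW, hvK⟩ := Finset.not_subset.1 hW
    have hD : 0 < D := (Nat.zero_le _).trans_lt (hlow v)
    have hvc := Finset.card_erase_add_one hvW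
    -- The closed neighbourhoods of the rest of `W`: a vertex outside `X` is neither in that rest
    -- nor adjacent to it.
    set X := (W.erase v).biUnion fun u => insert u (Finset.univ.filter fun x => G.Adj u x) with hX
    have hXc : X.card ≤ (W.erase v).card * D := by
      refine Finset.card_biUnion_le_card_mul _ _ _ fun u _ => ?_
      refine (Finset.card_insert_le _ _).trans ?_
      simpa [nbrCount] using hlow u
    -- The exchange requires `{v}` to be disjoint from the avoided set, but `v` may be adjacent to
    -- the rest of `W`; so `v` is removed from `X`. The new vertex differs from `v` anyway, since
    -- only one of them is in the layer.
    obtain ⟨A, hAK, hAc, hAX, hAs⟩ := exists_score_le_of_subset_lowBall (G := G) (goal := .max)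
      (r := 0) (M := M) (C := {v}) (X := X \ {v}) (v := v) hD (by simp [lowBall])
      Finset.disjoint_sdiff (by
        refine lt_of_le_of_lt ?_ hM
        rw [pow_zero, mul_one]
        exact (Finset.card_le_card Finset.sdiff_subset).trans
          (hXc.trans (Nat.mul_le_mul_right _ (by omega))))
    rw [Finset.card_singleton] at hAc hAK
    obtain ⟨w, rfl⟩ := Finset.card_eq_one.1 hAc
    rw [Finset.singleton_subset_iff] at hAK
    rw [score_max_le_iff] at hAs
    have hwv : w ≠ v := by rintro rfl; exact hvK hAK
    have hwX : w ∉ X := fun hw => Finset.disjoint_left.1 hAX (Finset.mem_singleton_self w)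
      (by simp [hw, hwv])
    simp only [hX, Finset.mem_biUnion, Finset.mem_insert, Finset.mem_filter, Finset.mem_univ,
      true_and, not_exists, not_and, not_or] at hwX
    have hwW : w ∉ W.erase v := fun h => (hwX w h).1 rfl
    -- Removing `v` loses at most its degree. Adding `w` gains its full degree, which is at least as
    -- large, because `w` is not adjacent to the rest.
    have hcut : cutValue G W ≤ cutValue G (W.erase v ∪ {w}) := by
      have h1 := cutValue_union_le (G := G) (W.erase v) {v}
      have h2 := add_le_cutValue_union (G := G) (A := W.erase v) (B := {w})
        (by simpa using hwW) fun a ha b hb => by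
          rw [Finset.mem_singleton.1 hb]; exact (hwX a ha).2
      have h3 : W.erase v ∪ {v} = W := by
        rw [Finset.union_comm, ← Finset.insert_eq, Finset.insert_erase hvW]
      rw [h3] at h1
      omega
    have hc : (W.erase v ∪ {w}).card = W.card := by
      rw [Finset.card_union_of_disjoint (by simpa using hwW), Finset.card_singleton, hvc]
    have hlt : ((W.erase v ∪ {w}) \ kernelLayer G .max D 0 M 1).card <
        (W \ kernelLayer G .max D 0 M 1).card := by
      refine Finset.card_lt_card (Finset.ssubset_iff_of_subset (fun x hx => ?_) |>.2
        ⟨v, by simp [hvW, hvK], by simp [hwv.symm]⟩)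
      simp only [Finset.mem_sdiff, Finset.mem_union, Finset.mem_erase,
        Finset.mem_singleton] at hx ⊢
      rcases hx with ⟨hx | rfl, hx'⟩
      · exact ⟨hx.2, hx'⟩
      · exact absurd hAK hx'
    obtain ⟨Z, hZ, hZc, hZv⟩ := ih _ (hm ▸ hlt) (W.erase v ∪ {w}) (hc ▸ hM) rfl
    exact ⟨Z, hZ, hZc.trans hc, hcut.trans hZv⟩

/-- If all degrees are low, `W` itself is moved into the kernel without loss. Otherwise the `k`
vertices of largest degree have degree sum at least `D`, compared with which the `k²` lost to inner
edges is negligible. -/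
theorem exists_subset_kernel_max {D M k d : ℕ} (hk : k ≤ n) (hD : k ^ 2 * (d + 1) + k < D)
    (hM : k * D < M) (W : Finset (Fin n)) (hW : W.card = k) :
    ∃ Z ⊆ kernel G .max D 0 M k, Z.card = k ∧
      d * cutValue G W ≤ d * cutValue G Z + cutValue G W := by
  rcases Nat.eq_zero_or_pos k with rfl | hk0
  · rw [Finset.card_eq_zero] at hW
    exact ⟨∅, by simp, rfl, by simp [hW]⟩
  have hK : kernelLayer G .max D 0 M 1 ⊆ kernel G .max D 0 M k := kernelLayer_subset_kernel hk0
  by_cases hlow : ∀ v, nbrCount G v < D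
  · obtain ⟨Z, hZ, hZc, hZv⟩ := exists_subset_kernelLayer_le_cutValue hlow W (hW ▸ hM)
    refine ⟨Z, hZ.trans hK, hZc.trans hW, ?_⟩
    nlinarith
  push Not at hlow
  obtain ⟨x, hx⟩ := hlow
  set key : Fin n → ℕ := fun v => bestScore G .max (lowBall G D 0 v) 1 with hkey
  have hkeyv : ∀ v, key v = 1 + nbrCount G v := fun v => by
    have : Finset.powersetCard 1 {v} = {{v}} := by
      simpa using Finset.powersetCard_self ({v} : Finset (Fin n))
    simp [hkey, bestScore, lowBall, this, score, cutValue_singleton]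
  set Z := topRanked key k with hZ
  have hZc : Z.card = k := le_antisymm (card_topRanked_le _ _) (le_card_topRanked hk)
  have hZle : ∀ z ∈ Z, ∀ w ∉ Z, nbrCount G w ≤ nbrCount G z := fun z hz w hw => by
    have := key_le_of_notMem_topRanked hw hz
    simpa [hkeyv] using this
  have hZK : Z ⊆ kernelLayer G .max D 0 M 1 := fun z hz =>
    lowBall_subset_kernelLayer (topRanked_mono (by nlinarith) hz) (mem_lowBall_self z)
  refine ⟨Z, hZK.trans hK, hZc, ?_⟩
  have h1 := sum_le_sum_of_forall_le (hW.trans hZc.symm) hZle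
  have h2 := sum_le_cutValue_add (G := G) Z
  have h3 := cutValue_le_sum (G := G) W
  have h4 : D ≤ ∑ v ∈ Z, nbrCount G v := by
    obtain ⟨z, hz⟩ : Z.Nonempty := Finset.card_pos.1 (by omega)
    by_cases hxZ : x ∈ Z
    · exact hx.trans (Finset.single_le_sum (f := nbrCount G) (fun _ _ => Nat.zero_le _) hxZ)
    · exact (hx.trans (hZle z hz x hxZ)).trans
        (Finset.single_le_sum (f := nbrCount G) (fun _ _ => Nat.zero_le _) hz)
  rw [hZc] at h2
  generalize ∑ v ∈ Z, nbrCount G v = a at *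
  generalize ∑ v ∈ W, nbrCount G v = b at *
  have h5 : d * k ^ 2 ≤ a := by nlinarith
  rcases Nat.eq_zero_or_pos d with rfl | hd
  · simp
  -- With `d = e + 1`, the goal amounts to `e * cutValue G W ≤ (e + 1) * cutValue G Z`. Both sides
  -- are compared with `e * a`, using `d * k² ≤ a`.
  obtain ⟨e, rfl⟩ : ∃ e, d = e + 1 := ⟨d - 1, by omega⟩
  have h6 : e * cutValue G W ≤ e * a := Nat.mul_le_mul_left _ (h3.trans h1)
  have h7 : (e + 1) * a ≤ (e + 1) * (cutValue G Z + k ^ 2) := Nat.mul_le_mul_left _ h2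
  nlinarith

end Kernel

/-! ## The program

Registers: 0 `n`, 1 `k`, 3 denominator of `ε`, 4 `k + 1`, 5 degree bound, 6 bound for balls, 7 number
of balls in a layer, 8 bound for the kernel, 9 number of rounds of the enumeration, 10 radius, 11 size
of the sets that are enumerated, 12 best score, 13 score, 14 size, 15 index into the adjacency
matrix, 16 carry, 17 and 18 auxiliary, 20 to 25 loop counters.

Arrays: 0 adjacency matrix, 1 output, 2 degrees, 3 set from which subsets are taken, 4 auxiliary,
5 subset, 6 keys, 7 kernel. -/

/-- The test for zero as an expression. -/
def RExpr.isZero (e : RExpr) : RExpr := .sub (.lit 1) e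

@[simp] theorem RExpr.eval_isZero (e : RExpr) (s : RState) :
    e.isZero.eval s = if e.eval s = 0 then 1 else 0 := by
  simp only [RExpr.isZero, RExpr.eval]
  split_ifs <;> omega

attribute [simp] RExpr.eval

/-- The vertices at which an array is nonzero. -/
def markedSet (n : ℕ) (f : ℕ → ℕ) : Finset (Fin n) :=
  Finset.univ.filter fun v => f v ≠ 0

@[simp] theorem mem_markedSet {n : ℕ} {f : ℕ → ℕ} {v : Fin n} : v ∈ markedSet n f ↔ f v ≠ 0 := by
  simp [markedSet]

namespace CutProg

open BProg

/-- Set array `a` to 0 on all vertices. -/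
def clearArr (a : ℕ) : BProg := loop 24 0 (put a (.reg 24) (.lit 0))

/-- Copy array `a` to array `b` on all vertices. -/
def copyArr (a b : ℕ) : BProg := loop 24 0 (put b (.reg 24) (.get a (.reg 24)))

/-- Add the values of `e` for all values of register 25 below `n` to register `x`. -/
def rowSum (x : ℕ) (e : RExpr) : BProg :=
  loop 25 0 (seq (assign x (.add (.reg x) e)) (assign 15 (.add (.reg 15) (.lit 1))))

/-- Compute the degrees. -/
def degrees : BProg :=
  seq (assign 15 (.lit 0)) <| loop 24 0 <| seq (assign 17 (.lit 0)) <|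
    seq (rowSum 17 (.get 0 (.reg 15))) (put 2 (.reg 24) (.reg 17))

/-- Whether a matrix entry stands for an edge that leaves the set in array 5. -/
def cutTerm : RExpr :=
  .isZero (.add (.add (.isZero (.get 5 (.reg 24))) (.get 5 (.reg 25)))
    (.isZero (.get 0 (.reg 15))))

/-- The contribution of a matrix entry to the score. -/
def scoreTerm : CutGoal → RExpr
  | .max => cutTerm
  | .min => .isZero cutTerm

/-- Compute score and size of the set in array 5. -/
def evalSet (goal : CutGoal) : BProg :=
  seq (assign 13 (.lit 1)) <| seq (assign 14 (.lit 0)) <| seq (assign 15 (.lit 0)) <|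
    loop 24 0 <| seq (assign 14 (.add (.reg 14) (.isZero (.isZero (.get 5 (.reg 24))))))
      (rowSum 13 (scoreTerm goal))

/-- Move on to the next subset of the set in array 3. -/
def nextSet : BProg :=
  seq (assign 16 (.lit 1)) <| loop 24 0 <|
    cond (.get 3 (.reg 24))
      (cond (.reg 16)
        (cond (.get 5 (.reg 24)) (put 5 (.reg 24) (.lit 0))
          (seq (put 5 (.reg 24) (.lit 1)) (assign 16 (.lit 0))))
        skip)
      skip

/-- Whether the set in array 5 has the right size and beats the best set so far. -/
def betterTest : RExpr :=
  .isZero (.add (.isZero (.sub (.reg 13) (.reg 12)))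
    (.add (.sub (.reg 14) (.reg 11)) (.sub (.reg 11) (.reg 14))))

/-- Find the best subset of the set in array 3. -/
def bestSet (goal : CutGoal) : BProg :=
  seq (assign 12 (.lit 0)) <| seq (clearArr 5) <| loop 23 9 <|
    seq (evalSet goal) <| seq (cond betterTest (seq (assign 12 (.reg 13)) (copyArr 5 1)) skip)
      nextSet

/-- Whether a matrix entry stands for an edge between vertices of low degree, one of them in the
set in array 3. -/
def stepTerm : RExpr :=
  .isZero (.add
    (.add (.isZero (.sub (.reg 5) (.get 2 (.reg 24)))) (.isZero (.sub (.reg 5) (.get 2 (.reg 25)))))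
    (.add (.isZero (.get 3 (.reg 25))) (.isZero (.get 0 (.reg 15)))))

/-- Add the neighbours to the set in array 3. -/
def expand : BProg :=
  seq
    (seq (assign 15 (.lit 0)) <| loop 24 0 <| seq (assign 17 (.get 3 (.reg 24))) <|
      seq (rowSum 17 stepTerm) (put 4 (.reg 24) (.reg 17)))
    (copyArr 4 3)

/-- Compute the ball around the vertex in register 21. -/
def ball : BProg :=
  seq (clearArr 3) <| seq (put 3 (.reg 21) (.lit 1)) <| loop 22 10 expand

/-- Compute the keys. -/
def keys (goal : CutGoal) : BProg :=
  loop 21 0 <| seq ball <| seq (bestSet goal) (put 6 (.reg 21) (.reg 12))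

/-- Whether vertex 25 precedes vertex 24. -/
def precedesTerm : RExpr :=
  .isZero (.isZero (.sub
    (.add (.get 6 (.reg 25)) (.isZero (.isZero (.sub (.reg 24) (.reg 25)))))
    (.get 6 (.reg 24))))

/-- Add array 3 to array 7. -/
def addBall : BProg :=
  loop 24 0 (put 7 (.reg 24) (.add (.get 7 (.reg 24)) (.get 3 (.reg 24))))

/-- Add the balls around the first vertices to the kernel. -/
def selectBalls : BProg :=
  loop 21 0 <| seq (assign 17 (.lit 0)) <| seq (assign 24 (.reg 21)) <|
    seq (rowSum 17 precedesTerm) <| cond (.sub (.reg 7) (.reg 17)) (seq ball addBall) skip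

/-- Compute the kernel. -/
def layers (goal : CutGoal) : BProg :=
  loop 20 4 <| seq (assign 11 (.reg 20)) <| seq (keys goal) selectBalls

/-- The program after the parameters have been computed. -/
def solve (goal : CutGoal) : BProg :=
  seq degrees <| seq (clearArr 7) <| seq (layers goal) <| seq (copyArr 7 3) <|
    seq (assign 11 (.reg 1)) (bestSet goal)

/-! ### Registers and arrays written by the subroutines -/

@[simp] theorem regs_clearArr (a : ℕ) : (clearArr a).regs = [24] := rfl
@[simp] theorem arrs_clearArr (a : ℕ) : (clearArr a).arrs = [a] := rfl
@[simp] theorem regs_copyArr (a b : ℕ) : (copyArr a b).regs = [24] := rfl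
@[simp] theorem arrs_copyArr (a b : ℕ) : (copyArr a b).arrs = [b] := rfl
@[simp] theorem regs_rowSum (x : ℕ) (e : RExpr) : (rowSum x e).regs = [25, x, 15] := rfl
@[simp] theorem arrs_rowSum (x : ℕ) (e : RExpr) : (rowSum x e).arrs = [] := rfl
@[simp] theorem regs_degrees : degrees.regs = [15, 24, 17, 25, 17, 15] := rfl
@[simp] theorem arrs_degrees : degrees.arrs = [2] := rfl
@[simp] theorem regs_evalSet (goal : CutGoal) :
    (evalSet goal).regs = [13, 14, 15, 24, 14, 25, 13, 15] := rfl
@[simp] theorem arrs_evalSet (goal : CutGoal) : (evalSet goal).arrs = [] := rfl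
@[simp] theorem regs_nextSet : nextSet.regs = [16, 24, 16] := rfl
@[simp] theorem arrs_nextSet : nextSet.arrs = [5, 5] := rfl
@[simp] theorem regs_bestSet (goal : CutGoal) : (bestSet goal).regs =
    [12, 24, 23, 13, 14, 15, 24, 14, 25, 13, 15, 12, 24, 16, 24, 16] := rfl
@[simp] theorem arrs_bestSet (goal : CutGoal) : (bestSet goal).arrs = [5, 1, 5, 5] := rfl
@[simp] theorem regs_expand : expand.regs = [15, 24, 17, 25, 17, 15, 24] := rfl
@[simp] theorem arrs_expand : expand.arrs = [4, 3] := rfl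
@[simp] theorem regs_ball : ball.regs = [24, 22, 15, 24, 17, 25, 17, 15, 24] := rfl
@[simp] theorem arrs_ball : ball.arrs = [3, 3, 4, 3] := rfl
@[simp] theorem regs_addBall : addBall.regs = [24] := rfl
@[simp] theorem arrs_addBall : addBall.arrs = [7] := rfl
@[simp] theorem regs_keys (goal : CutGoal) : (keys goal).regs = 21 :: (ball.regs ++
    ((bestSet goal).regs ++ [])) := rfl
@[simp] theorem arrs_keys (goal : CutGoal) : (keys goal).arrs = ball.arrs ++
    ((bestSet goal).arrs ++ [6]) := rfl
@[simp] theorem regs_selectBalls : selectBalls.regs =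
    21 :: 17 :: 24 :: 25 :: 17 :: 15 :: ((ball.regs ++ addBall.regs) ++ []) := rfl
@[simp] theorem arrs_selectBalls : selectBalls.arrs = (ball.arrs ++ addBall.arrs) ++ [] := rfl
@[simp] theorem regs_layers (goal : CutGoal) : (layers goal).regs =
    20 :: 11 :: ((keys goal).regs ++ selectBalls.regs) := rfl
@[simp] theorem arrs_layers (goal : CutGoal) :
    (layers goal).arrs = (keys goal).arrs ++ selectBalls.arrs := rfl

/-! ### Elementary loops -/

theorem clearArr_arr (a : ℕ) (s : RState) {v : ℕ} (hv : v < s.reg 0) :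
    ((clearArr a).run s).arr a v = 0 := by
  refine run_loop (fun i t => ∀ v < i, t.arr a v = 0) (by simp) (fun i _ t ht hi _ _ => ?_) v hv
  intro v hv
  simp only [run_put, RExpr.eval, hi, RState.setReg_arr, RState.setArr_arr, true_and]
  split_ifs with h
  · rfl
  · exact ht v (by omega)

theorem copyArr_arr {a b : ℕ} (hab : a ≠ b) (s : RState) {v : ℕ} (hv : v < s.reg 0) :
    ((copyArr a b).run s).arr b v = s.arr a v := by
  refine run_loop (fun i t => ∀ v < i, t.arr b v = s.arr a v) (by simp)
    (fun i _ t ht hi _ hta => ?_) v hv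
  intro v hv
  simp only [run_put, RExpr.eval, hi, RState.setReg_arr, RState.setArr_arr, true_and]
  split_ifs with h
  · rw [h, hta a (by simpa [arrs] using hab)]
  · exact ht v (by omega)

theorem markedSet_clearArr (a : ℕ) (s : RState) :
    markedSet (s.reg 0) (((clearArr a).run s).arr a) = ∅ := by
  ext v
  simp [clearArr_arr a s v.2]

theorem markedSet_copyArr {a b : ℕ} (hab : a ≠ b) (s : RState) :
    markedSet (s.reg 0) (((copyArr a b).run s).arr b) = markedSet (s.reg 0) (s.arr a) := by
  ext v
  simp [copyArr_arr hab s v.2]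

theorem markedSet_addBall (s : RState) :
    markedSet (s.reg 0) ((addBall.run s).arr 7) =
      markedSet (s.reg 0) (s.arr 7) ∪ markedSet (s.reg 0) (s.arr 3) := by
  have h : ∀ v < s.reg 0, (addBall.run s).arr 7 v = s.arr 7 v + s.arr 3 v := by
    intro v hv
    refine (run_loop (fun i t => (∀ v < i, t.arr 7 v = s.arr 7 v + s.arr 3 v) ∧
      ∀ v, i ≤ v → t.arr 7 v = s.arr 7 v) (by simp) (fun i _ t ht hi _ hta => ?_)).1 v hv
    simp only [run_put, RExpr.eval, hi, RState.setReg_arr, RState.setArr_arr, true_and]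
    refine ⟨fun v hv => ?_, fun v hv => ?_⟩
    · split_ifs with h
      · rw [h, hta 3 (by simp [arrs]), ht.2 i le_rfl]
      · exact ht.1 v (by omega)
    · rw [if_neg (by omega), ht.2 v (by omega)]
  ext v
  have := h v v.2
  simp only [mem_markedSet, Finset.mem_union, this]
  omega

/-- `rowSum` adds up the values `F v` of its expression; register 15 advances with `v`. -/
theorem rowSum_reg {x : ℕ} (hx : x ≠ 15 ∧ x ≠ 25 ∧ x ≠ 0) {e : RExpr} {s : RState} (F : ℕ → ℕ)
    (h : ∀ v < s.reg 0, ∀ t : RState, t.reg 25 = v → t.reg 15 = s.reg 15 + v → t.arr = s.arr →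
      (∀ y ∉ [25, x, 15], t.reg y = s.reg y) → e.eval t = F v) :
    ((rowSum x e).run s).reg x = s.reg x + ∑ v ∈ Finset.range (s.reg 0), F v ∧
      ((rowSum x e).run s).reg 15 = s.reg 15 + s.reg 0 := by
  refine run_loop (fun i t => t.reg x = s.reg x + ∑ v ∈ Finset.range i, F v ∧
    t.reg 15 = s.reg 15 + i) (by simp [hx]) (fun i hi t ht hti hr ha => ?_)
  have hF := h i hi t hti ht.2 (funext fun a => ha a (by simp [arrs])) hr
  simp only [run_seq, run_assign, RExpr.eval, RState.setReg_reg, hF, ht.1, ht.2,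
    Finset.sum_range_succ]
  simp only [hx.1, hx.2.1, hx.1.symm, if_true, if_false]
  norm_num
  omega

/-! ### The stored graph, degrees and scores -/

section

variable {n : ℕ} {G : SimpleGraph (Fin n)}

open Classical in
/-- A configuration that holds the graph `G`. -/
structure HasGraph (G : SimpleGraph (Fin n)) (s : RState) : Prop where
  size : s.reg 0 = n
  adj : ∀ u v : Fin n, s.arr 0 (u * n + v) = if G.Adj u v then 1 else 0

/-- A configuration that holds the graph `G` and its degrees. -/
structure HasDegrees (G : SimpleGraph (Fin n)) (s : RState) : Prop extends HasGraph G s where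
  deg : ∀ v : Fin n, s.arr 2 v = nbrCount G v

theorem HasGraph.of_eq {s t : RState} (h : HasGraph G s) (h0 : t.reg 0 = s.reg 0)
    (h1 : t.arr 0 = s.arr 0) : HasGraph G t :=
  ⟨h0.trans h.size, by rw [h1]; exact h.adj⟩

theorem HasDegrees.of_eq {s t : RState} (h : HasDegrees G s) (h0 : t.reg 0 = s.reg 0)
    (h1 : t.arr 0 = s.arr 0) (h2 : t.arr 2 = s.arr 2) : HasDegrees G t :=
  ⟨h.toHasGraph.of_eq h0 h1, by rw [h2]; exact h.deg⟩

theorem HasDegrees.run {s : RState} (h : HasDegrees G s) {p : BProg} (h0 : 0 ∉ p.regs)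
    (h1 : 0 ∉ p.arrs) (h2 : 2 ∉ p.arrs) : HasDegrees G (p.run s) :=
  h.of_eq (run_reg h0 s) (run_arr h1 s) (run_arr h2 s)

theorem degrees_hasDegrees {s : RState} (h : HasGraph G s) : HasDegrees G (degrees.run s) := by
  refine ⟨h.of_eq (run_reg (by simp) s) (run_arr (by simp) s), ?_⟩
  -- The machine has no multiplication, so the index `i * n` of the current row is maintained by
  -- incrementing register 15 through the whole matrix.
  have key := run_loop (x := 24) (r := 0) (p := seq (assign 17 (.lit 0)) <|
    seq (rowSum 17 (.get 0 (.reg 15))) (put 2 (.reg 24) (.reg 17))) (s := s.setReg 15 0)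
    (fun i t => t.reg 15 = i * n ∧ ∀ v : Fin n, v < i → t.arr 2 v = nbrCount G v)
    (by simp) (fun i hi t ht hti hr ha => ?_)
  · intro v
    exact key.2 v (by simp [h.size])
  have hin : i < n := by simpa [h.size] using hi
  have h0 : t.reg 0 = n := by rw [hr 0 (by simp [regs])]; simpa using h.size
  have ha0 : t.arr 0 = s.arr 0 := ha 0 (by simp [arrs])
  obtain ⟨h17, h15⟩ := rowSum_reg (x := 17) (by simp) (e := .get 0 (.reg 15))
    (s := t.setReg 17 0) (fun v => s.arr 0 (i * n + v)) (fun v hv t' h1 h2 h3 _ => by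
      simp [h2, h3, ht.1, ha0])
  have h24 := run_reg (p := rowSum 17 (.get 0 (.reg 15))) (y := 24) (by simp) (t.setReg 17 0)
  have h2 := run_arr (p := rowSum 17 (.get 0 (.reg 15))) (a := 2) (by simp) (t.setReg 17 0)
  simp only [RState.setReg_reg, RState.setReg_arr, h0, ht.1, hti] at h17 h15 h24 h2
  norm_num at h17 h15 h24
  simp only [run_seq, run_assign, run_put, RExpr.eval, RState.setReg_reg, RState.setArr_reg,
    RState.setReg_arr, RState.setArr_arr, h17, h15, h24, h2]
  refine ⟨by simp; ring, fun v hv => ?_⟩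
  split_ifs with hvi
  · rw [nbrCount, Finset.card_filter, Finset.sum_range]
    refine Finset.sum_congr rfl fun u _ => ?_
    rw [← hvi.2, h.adj v u]
  · have : (v : ℕ) ≠ i := fun h => hvi ⟨trivial, h⟩
    exact ht.2 v (by omega)

/-! ### Scores -/

open Classical in
theorem cutValue_eq_sum (f : ℕ → ℕ) : cutValue G (markedSet n f) =
    ∑ u : Fin n, ∑ v : Fin n, if f u ≠ 0 ∧ f v = 0 ∧ G.Adj u v then 1 else 0 := by
  rw [cutValue_eq_card, Finset.card_filter, Fintype.sum_prod_type]
  simp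

/-- Scores arise by addition alone: for minimization the matrix entries that are not cut edges are
counted, which gives `n * n` minus the cut value. -/
theorem evalSet_reg (goal : CutGoal) {s : RState} (h : HasGraph G s) :
    ((evalSet goal).run s).reg 13 = score G goal (markedSet n (s.arr 5)) ∧
      ((evalSet goal).run s).reg 14 = (markedSet n (s.arr 5)).card := by
  classical
  set c : ℕ → ℕ → ℕ := fun u v =>
    if s.arr 5 u ≠ 0 ∧ s.arr 5 v = 0 ∧ s.arr 0 (u * n + v) ≠ 0 then 1 else 0 with hc
  set F : ℕ → ℕ → ℕ := fun u v => match goal with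
    | .max => c u v
    | .min => 1 - c u v with hF
  have key := run_loop (x := 24) (r := 0)
    (p := seq (assign 14 (.add (.reg 14) (.isZero (.isZero (.get 5 (.reg 24))))))
      (rowSum 13 (scoreTerm goal))) (s := ((s.setReg 13 1).setReg 14 0).setReg 15 0)
    (fun i t => t.reg 15 = i * n ∧
      t.reg 13 = 1 + ∑ u ∈ Finset.range i, ∑ v ∈ Finset.range n, F u v ∧
      t.reg 14 = ∑ u ∈ Finset.range i, if s.arr 5 u ≠ 0 then 1 else 0)
    (by simp) (fun i hi t ht hti hr ha => ?_)
  · simp only [RState.setReg_reg, h.size] at key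
    norm_num at key
    have h13 : ((evalSet goal).run s).reg 13 = _ := key.2.1
    have h14 : ((evalSet goal).run s).reg 14 = _ := key.2.2
    rw [h13, h14]
    refine ⟨?_, ?_⟩
    · have hcut : ∑ u ∈ Finset.range n, ∑ v ∈ Finset.range n, c u v =
          cutValue G (markedSet n (s.arr 5)) := by
        rw [cutValue_eq_sum, Finset.sum_range]
        refine Finset.sum_congr rfl fun u _ => ?_
        rw [Finset.sum_range]
        refine Finset.sum_congr rfl fun v _ => ?_
        simp [hc, h.adj u v]
      cases goal with
      | max => simp only [hF, score, hcut]
      | min =>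
        simp only [hF, score, ← hcut]
        have : ∑ u ∈ Finset.range n, ∑ v ∈ Finset.range n, (1 - c u v) +
            ∑ u ∈ Finset.range n, ∑ v ∈ Finset.range n, c u v = n * n := by
          rw [← Finset.sum_add_distrib]
          have h1 : ∀ u v, 1 - c u v + c u v = 1 := fun u v => by
            simp only [hc]; split_ifs <;> rfl
          simp [← Finset.sum_add_distrib, h1]
        omega
    · rw [markedSet, Finset.card_filter, Finset.sum_range]
      exact Finset.sum_congr rfl fun u _ => by split_ifs <;> omega
  have h0 : t.reg 0 = n := by rw [hr 0 (by simp [regs])]; simpa using h.size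
  have ha' : t.arr = s.arr := funext fun a => ha a (by simp [arrs])
  set t₁ := t.setReg 14 (t.reg 14 + if s.arr 5 i ≠ 0 then 1 else 0) with ht₁
  obtain ⟨h13, h15⟩ := rowSum_reg (x := 13) (by simp) (e := scoreTerm goal)
    (s := t₁) (fun v => F i v) (fun v hv t' h1 h2 h3 h4 => by
      have h24 : t'.reg 24 = i := by rw [h4 24 (by simp)]; simp [ht₁, hti]
      have h15 : t'.reg 15 = i * n + v := by rw [h2]; simp [ht₁, ht.1]
      have h3' : t'.arr = s.arr := by rw [h3]; simp [ht₁, ha']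
      have hcut : cutTerm.eval t' = c i v := by
        simp only [cutTerm, RExpr.eval_isZero, RExpr.eval, h1, h24, h15, h3', hc]
        clear * -
        split_ifs <;> omega
      cases goal with
      | max => simpa [scoreTerm, hF] using hcut
      | min =>
        simp only [scoreTerm, hF, RExpr.eval_isZero, hcut]
        generalize c i v = x
        split_ifs <;> omega)
  have h14 := run_reg (p := rowSum 13 (scoreTerm goal)) (y := 14) (by simp) t₁
  have hrun : (seq (assign 14 (.add (.reg 14) (.isZero (.isZero (.get 5 (.reg 24))))))
      (rowSum 13 (scoreTerm goal))).run t = (rowSum 13 (scoreTerm goal)).run t₁ := by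
    simp only [run_seq, run_assign, ht₁, RExpr.eval, RExpr.eval_isZero, hti, ha']
    congr 3
    clear * -
    split_ifs <;> omega
  rw [hrun]
  simp only [RState.setReg_reg, Finset.sum_range_succ, h13, h14, h15]
  simp [ht₁, ht.1, ht.2.1, ht.2.2, h0]
  exact ⟨by ring, by ring⟩

end

end CutProg

namespace CutProg

open BProg

/-! ### Enumeration of subsets -/

/-- Binary increment: the carry reaches bit `r` exactly when `2 ^ r` divides `j + 1`. It then flips
that bit, and moves on exactly when the bit was set. -/
theorem testBit_add_one_and_dvd (j r : ℕ) :
    (j + 1).testBit r = (j.testBit r ^^ decide (2 ^ r ∣ j + 1)) ∧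
      (2 ^ (r + 1) ∣ j + 1 ↔ 2 ^ r ∣ j + 1 ∧ j.testBit r = true) := by
  induction r generalizing j with
  | zero =>
    simp only [Nat.testBit_zero, pow_zero, one_dvd, decide_true, zero_add, pow_one, true_and]
    constructor
    · rcases Nat.mod_two_eq_zero_or_one j with h | h <;> simp [Nat.add_mod, h]
    · rw [decide_eq_true_eq]; omega
  | succ r ih =>
    rw [Nat.testBit_succ, Nat.testBit_succ]
    rcases Nat.mod_two_eq_zero_or_one j with h | h
    · have h1 : (j + 1) / 2 = j / 2 := by omega
      have h2 : ∀ m, ¬ 2 ^ (m + 1) ∣ j + 1 := fun m hm => by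
        have : 2 ∣ j + 1 := (Dvd.intro_left (2 ^ m) rfl).trans hm
        omega
      simp [h1, h2]
    · have h1 : (j + 1) / 2 = j / 2 + 1 := by omega
      have h2 : ∀ m, 2 ^ (m + 1) ∣ j + 1 ↔ 2 ^ m ∣ j / 2 + 1 := fun m => by
        have : j + 1 = (j / 2 + 1) * 2 := by omega
        rw [this, pow_succ, Nat.mul_dvd_mul_iff_right (by norm_num)]
      simp only [h1, (ih (j / 2)).1, h2, (ih (j / 2)).2, and_self]

/-- The characteristic function of the `j`-th subset of the support of `f`. -/
def subsetBit (f : ℕ → ℕ) (j v : ℕ) : ℕ :=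
  if f v ≠ 0 ∧ j.testBit (Nat.count (fun u => f u ≠ 0) v) = true then 1 else 0

/-- Array 5 is a binary counter whose digits sit at the support of array 3; the vertex `i` holds
digit `c i`, and the carry passes unchanged over other vertices. -/
theorem nextSet_arr {s : RState} {j : ℕ}
    (h : ∀ v < s.reg 0, s.arr 5 v = subsetBit (s.arr 3) j v) {v : ℕ} (hv : v < s.reg 0) :
    (nextSet.run s).arr 5 v = subsetBit (s.arr 3) (j + 1) v := by
  set p := cond (.get 3 (.reg 24))
      (cond (.reg 16)
        (cond (.get 5 (.reg 24)) (put 5 (.reg 24) (.lit 0))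
          (seq (put 5 (.reg 24) (.lit 1)) (assign 16 (.lit 0))))
        skip)
      skip with hp
  set c : ℕ → ℕ := Nat.count fun u => s.arr 3 u ≠ 0 with hc
  have key := run_loop (x := 24) (r := 0) (p := p) (s := s.setReg 16 1)
    (fun i t => (∀ v < i, t.arr 5 v = subsetBit (s.arr 3) (j + 1) v) ∧
      (∀ v, i ≤ v → v < s.reg 0 → t.arr 5 v = subsetBit (s.arr 3) j v) ∧
      t.reg 16 = if 2 ^ c i ∣ j + 1 then 1 else 0)
    ⟨by simp, by simpa using h, by simp [hc]⟩ (fun i hi t ht hti hr ha => ?_)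
  · exact key.1 v (by simpa using hv)
  simp only [RState.setReg_reg] at hi
  norm_num at hi
  obtain ⟨ht1, ht2, ht3⟩ := ht
  have h3 : t.arr 3 = s.arr 3 := ha 3 (by simp [hp, arrs])
  have h5 := ht2 i le_rfl hi
  obtain ⟨hb, hd⟩ := testBit_add_one_and_dvd j (c i)
  have hsub : subsetBit (s.arr 3) j i =
      if s.arr 3 i ≠ 0 ∧ j.testBit (c i) = true then 1 else 0 := rfl
  have hsub' : subsetBit (s.arr 3) (j + 1) i =
      if s.arr 3 i ≠ 0 ∧ (j + 1).testBit (c i) = true then 1 else 0 := rfl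
  have hci : c (i + 1) = c i + if s.arr 3 i ≠ 0 then 1 else 0 := Nat.count_succ _ _
  have hpt : p.run t = if s.arr 3 i ≠ 0 then
      if t.reg 16 ≠ 0 then
        if t.arr 5 i ≠ 0 then t.setArr 5 i 0 else (t.setArr 5 i 1).setReg 16 0
      else t
    else t := by
    simp only [hp, run_cond, RExpr.eval, hti, h3, run_put, run_seq, run_assign, run_skip]
  suffices H : (p.run t).arr 5 i = subsetBit (s.arr 3) (j + 1) i ∧
      (∀ v ≠ i, (p.run t).arr 5 v = t.arr 5 v) ∧
      (p.run t).reg 16 = if 2 ^ c (i + 1) ∣ j + 1 then 1 else 0 by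
    refine ⟨fun v hv => ?_, fun v hv hv' => ?_, ?_⟩
    · rw [RState.setReg_arr]
      rcases Nat.lt_succ_iff_lt_or_eq.1 hv with hv | rfl
      · rw [H.2.1 v hv.ne, ht1 v hv]
      · exact H.1
    · rw [RState.setReg_arr, H.2.1 v (by omega), ht2 v (by omega) hv']
    · simpa using H.2.2
  rw [hpt, hsub', hci, ht3, h5, hsub, hb]
  by_cases hf : s.arr 3 i = 0
  · simp [hf, ht3, h5, hsub]
  by_cases hdv : 2 ^ c i ∣ j + 1
  · by_cases hj : j.testBit (c i) = true
    · simp [hf, hdv, hj, hd, ht3]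
      exact fun v hv h => absurd h hv
    · simp [hf, hdv, hj, hd]
      exact fun v hv h => absurd h hv
  · simp [hf, hdv, hd, ht3, h5, hsub]

theorem card_markedSet (n : ℕ) (f : ℕ → ℕ) :
    (markedSet n f).card = Nat.count (fun u => f u ≠ 0) n := by
  rw [markedSet, Finset.card_filter, Nat.count_eq_card_filter_range, Finset.card_filter,
    Finset.sum_range]

/-- Bit `p` of the witness records whether `A` contains the element that has exactly `p`
predecessors in the support. -/
theorem exists_subsetBit_eq {n : ℕ} {f : ℕ → ℕ} {A : Finset (Fin n)} (hA : A ⊆ markedSet n f) :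
    ∃ j < 2 ^ (markedSet n f).card, markedSet n (subsetBit f j) = A := by
  classical
  refine ⟨Nat.ofBits fun p : Fin (markedSet n f).card =>
    decide (∃ v ∈ A, Nat.count (fun u => f u ≠ 0) v = p), Nat.ofBits_lt_two_pow _, ?_⟩
  ext v
  rw [mem_markedSet]
  by_cases hv : f v = 0
  · simp only [subsetBit, hv, ne_eq, not_true_eq_false, false_and, if_false, false_iff]
    exact fun hvA => mem_markedSet.1 (hA hvA) hv
  have hlt : Nat.count (fun u => f u ≠ 0) v < (markedSet n f).card := by
    rw [card_markedSet]
    exact Nat.count_strict_mono hv v.2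
  rw [subsetBit, Nat.testBit_ofBits_lt _ _ hlt]
  simp only [ne_eq, hv, not_false_eq_true, true_and, decide_eq_true_eq, ite_eq_right_iff,
    one_ne_zero, imp_false, not_not]
  constructor
  · rintro ⟨u, hu, huv⟩
    have := Nat.count_injective (p := fun u => f u ≠ 0) (mem_markedSet.1 (hA hu)) hv huv
    rwa [← Fin.ext this]
  · exact fun h => ⟨v, h, rfl⟩

theorem markedSet_subsetBit_subset (n : ℕ) (f : ℕ → ℕ) (j : ℕ) :
    markedSet n (subsetBit f j) ⊆ markedSet n f := by
  intro v hv
  rw [mem_markedSet] at hv ⊢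
  exact fun h => hv (by simp [subsetBit, h])

/-! ### Exhaustive search over subsets -/

section

variable {n : ℕ} {G : SimpleGraph (Fin n)}

theorem markedSet_congr {f g : ℕ → ℕ} (h : ∀ v < n, f v = g v) : markedSet n f = markedSet n g := by
  ext v
  simp [h v v.2]

theorem betterTest_eval_ne_zero (s : RState) :
    betterTest.eval s ≠ 0 ↔ s.reg 12 < s.reg 13 ∧ s.reg 14 = s.reg 11 := by
  have h : ∀ a b : ℕ, (if (if a = 0 then 1 else 0) + b = 0 then 1 else 0) ≠ 0 ↔ a ≠ 0 ∧ b = 0 := by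
    intro a b
    by_cases a = 0 <;> by_cases b = 0 <;> simp [*]
  simp only [betterTest, RExpr.eval_isZero, RExpr.eval]
  exact (h _ _).trans (by omega)

/-- More rounds than subsets are harmless: the counter merely wraps around, since bits beyond the
support are ignored. The best score starts at 0, below every score, so array 1 is overwritten
whenever a set of the right size exists. -/
theorem bestSet_run (goal : CutGoal) {s : RState} (h : HasGraph G s) {X : Finset (Fin n)}
    (hX : markedSet n (s.arr 3) = X) (hE : 2 ^ X.card ≤ s.reg 9) :
    ((bestSet goal).run s).reg 12 = bestScore G goal X (s.reg 11) ∧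
      (0 < bestScore G goal X (s.reg 11) →
        markedSet n (((bestSet goal).run s).arr 1) ⊆ X ∧
        (markedSet n (((bestSet goal).run s).arr 1)).card = s.reg 11 ∧
        score G goal (markedSet n (((bestSet goal).run s).arr 1)) =
          bestScore G goal X (s.reg 11)) := by
  subst hX
  set f := s.arr 3 with hf
  set A : ℕ → Finset (Fin n) := fun j => markedSet n (subsetBit f j) with hA
  set s₁ := (clearArr 5).run (s.setReg 12 0) with hs₁
  have hs₁r : ∀ y ∉ [24, 12], s₁.reg y = s.reg y := fun y hy => by
    rw [List.mem_pair, not_or] at hy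
    rw [hs₁, run_reg (by simpa using hy.1)]
    simp [hy.2]
  have hs₁a : ∀ a ≠ 5, s₁.arr a = s.arr a := fun a ha => by
    rw [hs₁, run_arr (by simpa using ha)]
    rfl
  have key := run_loop (x := 23) (r := 9) (p := seq (evalSet goal) <|
    seq (cond betterTest (seq (assign 12 (.reg 13)) (copyArr 5 1)) skip) nextSet) (s := s₁)
    (fun j t => (∀ v < n, t.arr 5 v = subsetBit f j v) ∧
      (∀ i < j, (A i).card = s.reg 11 → score G goal (A i) ≤ t.reg 12) ∧
      (t.reg 12 = 0 ∨ ∃ i, markedSet n (t.arr 1) = A i ∧ (A i).card = s.reg 11 ∧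
        score G goal (A i) = t.reg 12))
    ⟨fun v hv => ?_, by simp, .inl ?_⟩ (fun j hj t ht htj hr ha => ?_)
  · have hrun : (bestSet goal).run s = (loop 23 9 (seq (evalSet goal) <|
      seq (cond betterTest (seq (assign 12 (.reg 13)) (copyArr 5 1)) skip) nextSet)).run s₁ := rfl
    rw [← hrun, hs₁r 9 (by simp)] at key
    set t := (bestSet goal).run s
    obtain ⟨-, h1, h2⟩ := key
    have hle : bestScore G goal (markedSet n f) (s.reg 11) ≤ t.reg 12 := by
      refine Finset.sup_le fun B hB => ?_
      rw [Finset.mem_powersetCard] at hB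
      obtain ⟨j, hj, rfl⟩ := exists_subsetBit_eq hB.1
      exact h1 j (hj.trans_le hE) hB.2
    rcases h2 with h2 | ⟨i, hi1, hi2, hi3⟩
    · have h0 : bestScore G goal (markedSet n f) (s.reg 11) = 0 := by omega
      exact ⟨by omega, fun h => by omega⟩
    · have hge := score_le_bestScore (G := G) (goal := goal) (markedSet_subsetBit_subset n f i)
      change score G goal (A i) ≤ bestScore G goal _ (A i).card at hge
      rw [hi2] at hge
      have heq : t.reg 12 = bestScore G goal (markedSet n f) (s.reg 11) := by omega
      rw [hi1]
      exact ⟨heq, fun _ => ⟨markedSet_subsetBit_subset n f i, hi2, hi3.trans heq⟩⟩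
  · have h1 : (s₁.setReg 23 0).arr 5 v = 0 := by
      rw [RState.setReg_arr, hs₁]
      exact clearArr_arr 5 _ (by simpa [h.size] using hv)
    rw [h1]
    simp [subsetBit]
  · simp [hs₁, run_reg (p := clearArr 5) (y := 12) (by simp)]
  obtain ⟨ht1, ht2, ht3⟩ := ht
  have h0 : t.reg 0 = n := by
    rw [hr 0 (by simp [regs]), hs₁r 0 (by simp), h.size]
  have h11 : t.reg 11 = s.reg 11 := by
    rw [hr 11 (by simp [regs]), hs₁r 11 (by simp)]
  have ha3 : t.arr 3 = f := by rw [ha 3 (by simp [arrs]), hs₁a 3 (by simp)]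
  have ha0 : t.arr 0 = s.arr 0 := by rw [ha 0 (by simp [arrs]), hs₁a 0 (by simp)]
  have htA : markedSet n (t.arr 5) = A j := markedSet_congr ht1
  obtain ⟨h13, h14⟩ := evalSet_reg goal (h.of_eq (h0.trans h.size.symm) ha0)
  rw [htA] at h13 h14
  set t₁ := (evalSet goal).run t with ht₁
  have ht₁r : ∀ y ∈ [0, 11, 12], t₁.reg y = t.reg y := fun y hy => by
    rw [ht₁, run_reg]
    simp only [List.mem_cons, List.not_mem_nil, or_false] at hy
    rcases hy with rfl | rfl | rfl <;> simp
  have ht₁a : ∀ a, t₁.arr a = t.arr a := fun a => by rw [ht₁, run_arr (by simp)]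
  set t₂ := (cond betterTest (seq (assign 12 (.reg 13)) (copyArr 5 1)) skip).run t₁ with ht₂
  have h2 : t₂.reg 0 = n ∧ t₂.arr 3 = f ∧ t₂.arr 5 = t.arr 5 := by
    rw [ht₂, run_reg (by simp [regs]), run_arr (a := 3) (by simp [arrs]),
      run_arr (a := 5) (by simp [arrs]), ht₁r 0 (by simp), ht₁a, ht₁a]
    exact ⟨h0, ha3, rfl⟩
  obtain ⟨h20, h23, h25⟩ := h2
  have hfin : ((nextSet.run t₂).setReg 23 (j + 1)).reg 12 = t₂.reg 12 ∧
      ((nextSet.run t₂).setReg 23 (j + 1)).arr 1 = t₂.arr 1 := by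
    rw [RState.setReg_arr, run_arr (by simp), RState.setReg_reg, if_neg (by norm_num),
      run_reg (by simp)]
    exact ⟨rfl, rfl⟩
  simp only [run_seq, ← ht₁, ← ht₂, hfin.1, hfin.2]
  refine ⟨fun v hv => ?_, ?_⟩
  · rw [RState.setReg_arr, nextSet_arr (j := j) (fun v hv => ?_) (by rwa [h20]), h23]
    rw [h25, h23, ht1 v (by rwa [h20] at hv)]
  have h12 := ht₁r 12 (by simp)
  have h11' := ht₁r 11 (by simp)
  by_cases hb : betterTest.eval t₁ ≠ 0
  · have ht₂' : t₂ = (copyArr 5 1).run (t₁.setReg 12 (t₁.reg 13)) := by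
      rw [ht₂, run_cond, if_pos hb]; rfl
    have h212 : t₂.reg 12 = score G goal (A j) := by
      rw [ht₂', run_reg (by simp)]; simpa using h13
    have h21 : markedSet n (t₂.arr 1) = A j := by
      have hc := markedSet_copyArr (a := 5) (b := 1) (by norm_num) (t₁.setReg 12 (t₁.reg 13))
      have h0' : (t₁.setReg 12 (t₁.reg 13)).reg 0 = n := by
        simp [ht₁r 0 (by simp), h0]
      rw [h0', ← ht₂', RState.setReg_arr, ht₁a 5, htA] at hc
      exact hc
    rw [betterTest_eval_ne_zero] at hb
    refine ⟨fun i hi hic => ?_, .inr ⟨j, h21, by omega, h212.symm⟩⟩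
    rcases Nat.lt_succ_iff_lt_or_eq.1 hi with hi | rfl
    · have := ht2 i hi hic
      omega
    · exact h212.ge
  · have ht₂' : t₂ = t₁ := by rw [ht₂, run_cond, if_neg hb]; rfl
    rw [betterTest_eval_ne_zero] at hb
    rw [ht₂', h12, ht₁a 1]
    refine ⟨fun i hi hic => ?_, ht3⟩
    rcases Nat.lt_succ_iff_lt_or_eq.1 hi with hi | rfl
    · exact ht2 i hi hic
    · omega

end

end CutProg

namespace CutProg

open BProg

section

variable {n : ℕ} {G : SimpleGraph (Fin n)}

/-! ### Balls -/

/-- A sum of natural numbers vanishes exactly when all summands do, so the zero test of a sum serves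
as a conjunction. -/
theorem stepTerm_eval {s : RState} (h : HasDegrees G s) {t : RState} {u v : Fin n}
    (h5 : t.reg 5 = s.reg 5) (h24 : t.reg 24 = u) (h25 : t.reg 25 = v)
    (h15 : t.reg 15 = u * n + v) (h0 : t.arr 0 = s.arr 0) (h2 : t.arr 2 = s.arr 2)
    (h3 : t.arr 3 = s.arr 3) :
    stepTerm.eval t ≠ 0 ↔ nbrCount G u < s.reg 5 ∧ v ∈ markedSet n (s.arr 3) ∧
      nbrCount G v < s.reg 5 ∧ G.Adj u v := by
  have hz : ∀ (e : RExpr), e.isZero.eval t ≠ 0 ↔ e.eval t = 0 := fun e => by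
    simp [RExpr.isZero, RExpr.eval]; omega
  have hz' : ∀ (e : RExpr), e.isZero.eval t = 0 ↔ e.eval t ≠ 0 := fun e => by
    simp [RExpr.isZero, RExpr.eval]; omega
  have hA : s.arr 0 (u * n + v) ≠ 0 ↔ G.Adj u v := by
    rw [h.adj]
    split_ifs with hG <;> simp [hG]
  rw [stepTerm, hz]
  simp only [RExpr.eval, Nat.add_eq_zero_iff, hz', h5, h24, h25, h15, h0, h2, h3, h.deg, hA,
    mem_markedSet]
  constructor
  · rintro ⟨⟨h1, h2⟩, h3, h4⟩
    exact ⟨by omega, h3, by omega, h4⟩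
  · rintro ⟨h1, h2, h3, h4⟩
    exact ⟨⟨by omega, by omega⟩, h2, h4⟩

/-- The new marks are collected in array 4, so vertices added in this step do not spread further
within it. Entries may exceed 1; only being nonzero matters. -/
theorem markedSet_expand {s : RState} (h : HasDegrees G s) :
    markedSet n ((expand.run s).arr 3) = lowStep G (s.reg 5) (markedSet n (s.arr 3)) := by
  set p := seq (assign 17 (.get 3 (.reg 24))) <|
      seq (rowSum 17 stepTerm) (put 4 (.reg 24) (.reg 17)) with hp
  have key := run_loop (x := 24) (r := 0) (p := p) (s := s.setReg 15 0)
    (fun i t => t.reg 15 = i * n ∧ ∀ v : Fin n, v < i →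
      (t.arr 4 v ≠ 0 ↔ v ∈ lowStep G (s.reg 5) (markedSet n (s.arr 3))))
    (by simp) (fun i hi t ht hti hr ha => ?_)
  · set t := (loop 24 0 p).run (s.setReg 15 0) with ht
    have hrun : expand.run s = (copyArr 4 3).run t := rfl
    have h0 : t.reg 0 = n := by
      rw [ht, run_reg (by simp [hp, regs])]; simpa using h.size
    have hc := markedSet_copyArr (a := 4) (b := 3) (by norm_num) t
    rw [h0] at hc
    rw [hrun, hc]
    ext v
    rw [mem_markedSet]
    exact key.2 v (by simp [h.size])
  have hin : i < n := by simpa [h.size] using hi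
  have h0 : t.reg 0 = n := by rw [hr 0 (by simp [hp, regs])]; simpa using h.size
  have h5 : t.reg 5 = s.reg 5 := by rw [hr 5 (by simp [hp, regs])]; simp
  have ha0 : t.arr 0 = s.arr 0 := ha 0 (by simp [hp, arrs])
  have ha2 : t.arr 2 = s.arr 2 := ha 2 (by simp [hp, arrs])
  have ha3 : t.arr 3 = s.arr 3 := ha 3 (by simp [hp, arrs])
  set t₁ := t.setReg 17 (s.arr 3 i) with ht₁
  set F : ℕ → ℕ := fun v => stepTerm.eval (((t₁.setReg 25 v).setReg 15 (i * n + v))) with hF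
  have hcongr : ∀ t t' : RState, t.reg 5 = t'.reg 5 → t.reg 24 = t'.reg 24 →
      t.reg 25 = t'.reg 25 → t.reg 15 = t'.reg 15 → t.arr = t'.arr →
      stepTerm.eval t = stepTerm.eval t' := fun t t' h1 h2 h3 h4 h5 => by
    simp only [stepTerm, RExpr.isZero, RExpr.eval, h1, h2, h3, h4, h5]
  obtain ⟨h17, h15⟩ := rowSum_reg (x := 17) (by simp) (e := stepTerm) (s := t₁) F
    (fun v _ t' h1 h2 h3 h4 => by
      refine hcongr _ _ ?_ ?_ ?_ ?_ ?_
      · rw [h4 5 (by simp)]; simp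
      · rw [h4 24 (by simp)]; simp
      · simp [h1]
      · rw [h2]; simp [ht₁, ht.1]
      · rw [h3]; rfl)
  have h24 := run_reg (p := rowSum 17 stepTerm) (y := 24) (by simp) t₁
  have h4 := run_arr (p := rowSum 17 stepTerm) (a := 4) (by simp) t₁
  have h0' : t₁.reg 0 = n := by simp [ht₁, h0]
  have hrun : p.run t = (put 4 (.reg 24) (.reg 17)).run ((rowSum 17 stepTerm).run t₁) := by
    simp only [hp, run_seq, run_assign, RExpr.eval, hti, ha3, ht₁]
  rw [h0'] at h17 h15
  have h15' : t₁.reg 15 = i * n := by simp [ht₁, ht.1]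
  have h24' : t₁.reg 24 = i := by simp [ht₁, hti]
  have h17' : t₁.reg 17 = s.arr 3 i := by simp [ht₁]
  rw [h15'] at h15
  rw [h24'] at h24
  rw [h17'] at h17
  rw [hrun]
  simp only [run_put, RExpr.eval, RState.setReg_reg, RState.setArr_reg, RState.setReg_arr,
    RState.setArr_arr, h17, h15, h24, h4]
  refine ⟨by simp; ring, fun v hv => ?_⟩
  split_ifs with hvi
  · rw [mem_lowStep, mem_markedSet, ← hvi.2]
    have hsum : ∑ w ∈ Finset.range n, F w ≠ 0 ↔ ∃ u : Fin n, F u ≠ 0 := by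
      rw [Finset.sum_range, ne_eq, Finset.sum_eq_zero_iff]
      simp
    have hFv : ∀ u : Fin n, F u ≠ 0 ↔ nbrCount G v < s.reg 5 ∧ u ∈ markedSet n (s.arr 3) ∧
        nbrCount G u < s.reg 5 ∧ G.Adj v u := fun u =>
      stepTerm_eval h (by simp [ht₁, h5]) (by simp [h24', hvi.2]) (by simp) (by simp [hvi.2])
        (by simp [ht₁, ha0]) (by simp [ht₁, ha2]) (by simp [ht₁, ha3])
    have hor : ∀ a b : ℕ, a + b ≠ 0 ↔ a ≠ 0 ∨ b ≠ 0 := fun a b => by omega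
    rw [hor, hsum]
    simp only [hFv]
    constructor
    · rintro (h | ⟨u, h1, h2, h3, h4⟩)
      · exact .inl h
      · exact .inr ⟨h1, u, h2, h3, h4⟩
    · rintro (h | ⟨h1, u, h2, h3, h4⟩)
      · exact .inl h
      · exact .inr ⟨u, h1, h2, h3, h4⟩
  · have : (v : ℕ) ≠ i := fun h => hvi ⟨trivial, h⟩
    simpa [ht₁] using ht.2 v (by omega)

theorem markedSet_ball {s : RState} (h : HasDegrees G s) {v : Fin n} (hv : s.reg 21 = v) :
    markedSet n ((ball.run s).arr 3) = lowBall G (s.reg 5) (s.reg 10) v := by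
  set s₁ := ((clearArr 3).run s).setArr 3 v 1 with hs₁
  have hrun : ball.run s = (loop 22 10 expand).run s₁ := by
    simp only [ball, run_seq, run_put, RExpr.eval, hs₁, run_reg (p := clearArr 3) (y := 21)
      (by simp), hv]
  have hs₁r : ∀ y ≠ 24, s₁.reg y = s.reg y := fun y hy => by
    rw [hs₁, RState.setArr_reg, run_reg (by simpa using hy)]
  have hs₁a : ∀ a ≠ 3, s₁.arr a = s.arr a := fun a ha => by
    rw [hs₁, RState.setArr_arr_of_ne _ _ _ ha, run_arr (by simpa using ha)]
  have key := run_loop (x := 22) (r := 10) (p := expand) (s := s₁)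
    (fun i t => markedSet n (t.arr 3) = (lowStep G (s.reg 5))^[i] {v}) ?_
    (fun i hi t ht hti hr ha => ?_)
  · rw [hrun, lowBall]
    rwa [hs₁r 10 (by simp)] at key
  · ext w
    have := clearArr_arr 3 s (v := w) (by simp [h.size])
    simp [hs₁, this, Fin.ext_iff]
  · have h5 : t.reg 5 = s.reg 5 := by rw [hr 5 (by simp [regs]), hs₁r 5 (by simp)]
    have hd : HasDegrees G t := h.of_eq
      (by rw [hr 0 (by simp [regs]), hs₁r 0 (by simp)])
      (by rw [ha 0 (by simp), hs₁a 0 (by simp)])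
      (by rw [ha 2 (by simp), hs₁a 2 (by simp)])
    rw [RState.setReg_arr, markedSet_expand hd, h5, ht, Function.iterate_succ_apply']

/-! ### The kernel -/

theorem keys_arr (goal : CutGoal) {s : RState} (h : HasDegrees G s) (hD : 0 < s.reg 5)
    (hE : 2 ^ (s.reg 5 ^ s.reg 10) ≤ s.reg 9) (v : Fin n) :
    ((keys goal).run s).arr 6 v =
      bestScore G goal (lowBall G (s.reg 5) (s.reg 10) v) (s.reg 11) := by
  have key := run_loop (x := 21) (r := 0)
    (p := seq ball <| seq (bestSet goal) (put 6 (.reg 21) (.reg 12))) (s := s)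
    (fun i t => ∀ v : Fin n, v < i → t.arr 6 v =
      bestScore G goal (lowBall G (s.reg 5) (s.reg 10) v) (s.reg 11)) (by simp)
    (fun i hi t ht hti hr ha => ?_)
  · exact key v (by simp [h.size])
  rw [h.size] at hi
  have hreg : ∀ y ∈ [0, 5, 9, 10, 11], t.reg y = s.reg y := fun y hy => by
    refine hr y ?_
    simp only [List.mem_cons, List.not_mem_nil, or_false] at hy
    rcases hy with rfl | rfl | rfl | rfl | rfl <;> simp [regs]
  have hd : HasDegrees G t := h.of_eq (hreg 0 (by simp)) (ha 0 (by simp [arrs]))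
    (ha 2 (by simp [arrs]))
  have hX := markedSet_ball hd (v := ⟨i, hi⟩) hti
  rw [hreg 5 (by simp), hreg 10 (by simp)] at hX
  have hb := bestSet_run goal (hd.run (p := ball) (by simp) (by simp) (by simp)).toHasGraph hX
    ((Nat.pow_le_pow_right (by norm_num) (card_lowBall_le hD _ _)).trans (by
      rw [run_reg (by simp), hreg 9 (by simp)]; exact hE))
  rw [run_reg (p := ball) (y := 11) (by simp), hreg 11 (by simp)] at hb
  have h21 : ((bestSet goal).run (ball.run t)).reg 21 = i := by
    rw [run_reg (by simp), run_reg (by simp), hti]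
  have h6 : ((bestSet goal).run (ball.run t)).arr 6 = t.arr 6 := by
    rw [run_arr (by simp), run_arr (by simp)]
  intro v hv
  simp only [run_seq, run_put, RExpr.eval, RState.setReg_arr, RState.setArr_arr, h21, h6, hb.1,
    true_and]
  split_ifs with hvi
  · congr 2
    exact Fin.ext hvi.symm
  · exact ht v (by omega)

/-- Balls are not stored: each vertex gets its rank by counting the vertices that precede it, and
its ball is computed again if the rank is below the quota. -/
theorem markedSet_selectBalls {s : RState} (h : HasDegrees G s) :
    markedSet n ((selectBalls.run s).arr 7) = markedSet n (s.arr 7) ∪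
      (topRanked (fun v : Fin n => s.arr 6 v) (s.reg 7)).biUnion
        (lowBall G (s.reg 5) (s.reg 10)) := by
  set key : Fin n → ℕ := fun v => s.arr 6 v with hkey
  set p := seq (assign 17 (.lit 0)) <| seq (assign 24 (.reg 21)) <|
    seq (rowSum 17 precedesTerm) <| cond (.sub (.reg 7) (.reg 17)) (seq ball addBall) skip with hp
  have hloop := run_loop (x := 21) (r := 0) (p := p) (s := s)
    (fun i t => markedSet n (t.arr 7) = markedSet n (s.arr 7) ∪
      ((topRanked key (s.reg 7)).filter fun v : Fin n => (v : ℕ) < i).biUnion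
        (lowBall G (s.reg 5) (s.reg 10))) (by simp) (fun i hi t ht hti hr ha => ?_)
  · rw [Finset.filter_true_of_mem (fun v _ => by simp [h.size])] at hloop
    exact hloop
  rw [h.size] at hi
  have hreg : ∀ y ∈ [0, 5, 7, 10], t.reg y = s.reg y := fun y hy => by
    refine hr y ?_
    simp only [List.mem_cons, List.not_mem_nil, or_false] at hy
    rcases hy with rfl | rfl | rfl | rfl <;> simp [hp, regs]
  have ha6 : t.arr 6 = s.arr 6 := ha 6 (by simp [hp, arrs])
  set t₁ := (t.setReg 17 0).setReg 24 i with ht₁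
  set F : ℕ → ℕ := fun u => if s.arr 6 i < s.arr 6 u + (if u < i then 1 else 0) then 1 else 0
    with hF
  obtain ⟨h17, -⟩ := rowSum_reg (x := 17) (by simp) (e := precedesTerm) (s := t₁) F
    (fun u _ t' h1 _ h3 h4 => by
      have h24 : t'.reg 24 = i := by rw [h4 24 (by simp)]; simp [ht₁]
      have h3' : t'.arr 6 = s.arr 6 := by rw [h3]; exact ha6
      simp only [precedesTerm, RExpr.isZero, RExpr.eval, h1, h24, h3', hF]
      split_ifs <;> omega)
  set t₂ := (rowSum 17 precedesTerm).run t₁ with ht₂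
  have ht₂r : ∀ y ∉ [15, 17, 24, 25], t₂.reg y = t.reg y := fun y hy => by
    simp only [List.mem_cons, List.not_mem_nil, or_false, not_or] at hy
    rw [ht₂, run_reg (by simp [hy])]
    simp [ht₁, hy]
  have ht₂a : ∀ a, t₂.arr a = t.arr a := fun a => by
    rw [ht₂, run_arr (by simp)]; simp [ht₁]
  have hrank : t₂.reg 17 = keyRank key ⟨i, hi⟩ := by
    rw [h17, keyRank, Finset.card_filter]
    have : t₁.reg 0 = n := by simp [ht₁, hreg 0 (by simp), h.size]
    rw [this, Finset.sum_range]
    simp [ht₁, hF, hkey, Fin.lt_def]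
  have hrun : p.run t = (cond (.sub (.reg 7) (.reg 17)) (seq ball addBall) skip).run t₂ := by
    simp only [hp, run_seq, run_assign, RExpr.eval, ht₂, ht₁, RState.setReg_reg, hti]
    norm_num
  have hd : HasDegrees G t₂ := h.of_eq
    (by rw [ht₂r 0 (by simp), hreg 0 (by simp)])
    (by rw [ht₂a, ha 0 (by simp [hp, arrs])])
    (by rw [ht₂a, ha 2 (by simp [hp, arrs])])
  have hcond : (RExpr.sub (.reg 7) (.reg 17)).eval t₂ ≠ 0 ↔
      (⟨i, hi⟩ : Fin n) ∈ topRanked key (s.reg 7) := by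
    simp only [RExpr.eval, topRanked, Finset.mem_filter, Finset.mem_univ, true_and, hrank,
      ht₂r 7 (by simp), hreg 7 (by simp)]
    omega
  rw [RState.setReg_arr, hrun, run_cond]
  by_cases hc : (⟨i, hi⟩ : Fin n) ∈ topRanked key (s.reg 7)
  · have hfil : (topRanked key (s.reg 7)).filter (fun v : Fin n => (v : ℕ) < i + 1) =
        insert ⟨i, hi⟩ ((topRanked key (s.reg 7)).filter fun v : Fin n => (v : ℕ) < i) := by
      ext v
      simp only [Finset.mem_filter, Finset.mem_insert, Fin.ext_iff]
      constructor
      · rintro ⟨h1, h2⟩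
        by_cases hvi : (v : ℕ) = i
        · exact .inl hvi
        · exact .inr ⟨h1, by omega⟩
      · rintro (h1 | ⟨h1, h2⟩)
        · rw [show v = ⟨i, hi⟩ from Fin.ext h1]
          exact ⟨hc, by simp⟩
        · exact ⟨h1, by omega⟩
    have hbs := markedSet_ball hd (v := ⟨i, hi⟩) (by rw [ht₂r 21 (by simp), hti])
    have hadd := markedSet_addBall (ball.run t₂)
    rw [run_reg (by simp), hd.size, hbs, run_arr (p := ball) (by simp), ht₂a, ht,
      ht₂r 5 (by simp), ht₂r 10 (by simp), hreg 5 (by simp), hreg 10 (by simp)] at hadd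
    rw [if_pos (hcond.2 hc), run_seq, hadd, hfil, Finset.biUnion_insert]
    ext w
    simp only [Finset.mem_union]
    tauto
  · have hfil : (topRanked key (s.reg 7)).filter (fun v : Fin n => (v : ℕ) < i + 1) =
        (topRanked key (s.reg 7)).filter fun v : Fin n => (v : ℕ) < i := by
      refine Finset.filter_congr fun v hv => ?_
      have : (v : ℕ) ≠ i := fun hvi => hc (by rwa [show v = ⟨i, hi⟩ from Fin.ext hvi] at hv)
      omega
    rw [if_neg (fun h => hc (hcond.1 h)), run_skip, ht₂a, ht, hfil]

theorem markedSet_layers (goal : CutGoal) {s : RState} (h : HasDegrees G s) (hD : 0 < s.reg 5)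
    (hE : 2 ^ (s.reg 5 ^ s.reg 10) ≤ s.reg 9) (h7 : markedSet n (s.arr 7) = ∅) {k : ℕ}
    (hk : s.reg 4 = k + 1) :
    markedSet n (((layers goal).run s).arr 7) =
      kernel G goal (s.reg 5) (s.reg 10) (s.reg 7) k := by
  have key := run_loop (x := 20) (r := 4)
    (p := seq (assign 11 (.reg 20)) <| seq (keys goal) selectBalls) (s := s)
    (fun i t => markedSet n (t.arr 7) = (Finset.range i).biUnion
      (kernelLayer G goal (s.reg 5) (s.reg 10) (s.reg 7))) (by simpa using h7)
    (fun i hi t ht hti hr ha => ?_)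
  · rw [hk] at key
    exact key
  have hreg : ∀ y ∈ [0, 5, 7, 9, 10], t.reg y = s.reg y := fun y hy => by
    refine hr y ?_
    simp only [List.mem_cons, List.not_mem_nil, or_false] at hy
    rcases hy with rfl | rfl | rfl | rfl | rfl <;> simp [regs]
  have h5 : (t.setReg 11 i).reg 5 = s.reg 5 := by simp [hreg 5 (by simp)]
  have h9 : (t.setReg 11 i).reg 9 = s.reg 9 := by simp [hreg 9 (by simp)]
  have h10 : (t.setReg 11 i).reg 10 = s.reg 10 := by simp [hreg 10 (by simp)]
  have h11 : (t.setReg 11 i).reg 11 = i := by simp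
  have h7' : (t.setReg 11 i).reg 7 = s.reg 7 := by simp [hreg 7 (by simp)]
  have hd : HasDegrees G (t.setReg 11 i) := h.of_eq (by simp [hreg 0 (by simp)])
    (ha 0 (by simp [arrs])) (ha 2 (by simp [arrs]))
  have hkeys := keys_arr goal hd (by rw [h5]; exact hD) (by rw [h5, h9, h10]; exact hE)
  have hsel := markedSet_selectBalls (hd.run (p := keys goal) (by simp) (by simp) (by simp))
  rw [h5, h10, h11] at hkeys
  rw [run_reg (p := keys goal) (y := 5) (by simp), run_reg (p := keys goal) (y := 7) (by simp),
    run_reg (p := keys goal) (y := 10) (by simp), run_arr (p := keys goal) (a := 7) (by simp),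
    h5, h7', h10, RState.setReg_arr, ht] at hsel
  simp only [hkeys] at hsel
  simp only [run_seq, run_assign, RExpr.eval, hti, RState.setReg_arr, hsel]
  rw [Finset.range_add_one, Finset.biUnion_insert, Finset.union_comm]
  rfl

/-- The output of the program is a best set of `k` vertices in the kernel. -/
theorem solve_run (goal : CutGoal) {s : RState} (h : HasGraph G s) {k D r M : ℕ} (hD : 0 < D)
    (h1 : s.reg 1 = k) (h4 : s.reg 4 = k + 1) (h5 : s.reg 5 = D) (h7 : s.reg 7 = M)
    (h10 : s.reg 10 = r) (hE : 2 ^ ((k + 1) * (M * D ^ r)) ≤ s.reg 9) (hM : 0 < M)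
    {Z : Finset (Fin n)} (hZ : Z ⊆ kernel G goal D r M k) (hZk : Z.card = k) :
    (markedSet n (((solve goal).run s).arr 1)).card = k ∧
      score G goal Z ≤ score G goal (markedSet n (((solve goal).run s).arr 1)) := by
  set s₁ := (clearArr 7).run (degrees.run s) with hs₁
  have hd : HasDegrees G s₁ :=
    (degrees_hasDegrees h).run (p := clearArr 7) (by simp) (by simp) (by simp)
  have hs₁r : ∀ y ∉ [15, 17, 24, 25], s₁.reg y = s.reg y := fun y hy => by
    simp only [List.mem_cons, List.not_mem_nil, or_false, not_or] at hy
    rw [hs₁, run_reg (by simp [hy]), run_reg (by simp [hy])]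
  have h7s : markedSet n (s₁.arr 7) = ∅ := by
    have := markedSet_clearArr 7 (degrees.run s)
    rwa [(degrees_hasDegrees h).size] at this
  -- The number of rounds chosen for the kernel thus also suffices for every ball.
  have hpow : D ^ r ≤ (k + 1) * (M * D ^ r) :=
    (Nat.le_mul_of_pos_left _ hM).trans (Nat.le_mul_of_pos_left _ (by omega))
  have hK := markedSet_layers goal hd (by rwa [hs₁r 5 (by simp), h5]) (by
    rw [hs₁r 5 (by simp), hs₁r 10 (by simp), hs₁r 9 (by simp), h5, h10]
    exact (Nat.pow_le_pow_right (by norm_num) hpow).trans hE) h7s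
    (k := k) (by rw [hs₁r 4 (by simp), h4])
  rw [hs₁r 5 (by simp), hs₁r 10 (by simp), hs₁r 7 (by simp), h5, h10, h7] at hK
  set s₂ := (layers goal).run s₁ with hs₂
  have hd₂ : HasDegrees G s₂ := hd.run (by simp) (by simp) (by simp)
  set s₃ := ((copyArr 7 3).run s₂).setReg 11 k with hs₃
  have hs₃r : ∀ y ∈ [0, 9], s₃.reg y = s.reg y := fun y hy => by
    simp only [List.mem_cons, List.not_mem_nil, or_false] at hy
    rcases hy with rfl | rfl
    all_goals
      rw [hs₃, RState.setReg_reg, if_neg (by norm_num), run_reg (by simp), hs₂,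
        run_reg (by simp), hs₁r _ (by simp)]
  have hd₃ : HasGraph G s₃ := hd₂.toHasGraph.of_eq
    (by rw [hs₃, RState.setReg_reg, if_neg (by norm_num), run_reg (by simp)])
    (by rw [hs₃, RState.setReg_arr, run_arr (by simp)])
  have hX : markedSet n (s₃.arr 3) = kernel G goal D r M k := by
    have := markedSet_copyArr (a := 7) (b := 3) (by norm_num) s₂
    rw [hd₂.size, hK] at this
    exact this
  have hrun : (solve goal).run s = (bestSet goal).run s₃ := by
    have h1' : ((copyArr 7 3).run s₂).reg 1 = k := by
      rw [run_reg (by simp), hs₂, run_reg (by simp), hs₁r 1 (by simp), h1]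
    simp only [solve, run_seq, run_assign, RExpr.eval, ← hs₁, ← hs₂, h1', hs₃]
  have hbest := (bestSet_run goal hd₃ hX
    ((Nat.pow_le_pow_right (by norm_num) (card_kernel_le hD _ _ _)).trans (by
      rw [hs₃r 9 (by simp)]; exact hE))).2
  have h11 : s₃.reg 11 = k := by simp [hs₃]
  have hZs := score_le_bestScore (G := G) (goal := goal) hZ
  rw [hZk] at hZs
  rw [h11] at hbest
  -- Array 1 also holds leftovers of the searches for keys. As the kernel contains a set of size
  -- `k`, the final search overwrites them.
  obtain ⟨-, hc, hs⟩ := hbest ((score_pos goal Z).trans_le hZs)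
  rw [hrun]
  exact ⟨hc, hZs.trans hs.ge⟩

end

end CutProg

namespace CutProg

open BProg

/-! ### The parameters -/

/-- Bound for the degrees. -/
def degBound (k d : ℕ) : ℕ := k * (k * (d + 1)) + k + 1

/-- Number of balls in a layer of the kernel. -/
def ballCount (k d : ℕ) : ℕ := 1 + k * degBound k d ^ k

/-- Bound for the size of the kernel. -/
def kernelBound (k d : ℕ) : ℕ := (k + 1) * (ballCount k d * degBound k d ^ k)

/-- Add the value of `e` to register `x`, as often as register `r` says. -/
def addMany (x c r : ℕ) (e : RExpr) : BProg := loop c r (assign x (.add (.reg x) e))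

/-- Multiplication by repeated addition; the summand must not depend on the accumulator or the
counter. -/
theorem addMany_reg {x c r : ℕ} (hx : x ≠ c) {e : RExpr} {s : RState} (V : ℕ)
    (h : ∀ t : RState, (∀ y ∉ [c, x], t.reg y = s.reg y) → e.eval t = V) :
    ((addMany x c r e).run s).reg x = s.reg x + s.reg r * V := by
  refine run_loop (fun i t => t.reg x = s.reg x + i * V) (by simp [hx])
    (fun i hi t ht hti hr ha => ?_)
  simp only [run_assign, RExpr.eval, RState.setReg_reg, if_neg hx, if_true, h t hr, ht]
  ring

/-- Compute the bound for the degrees. -/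
def setDegBound : BProg :=
  seq (assign 4 (.add (.reg 1) (.lit 1))) <| seq (assign 5 (.lit 0)) <|
    seq (loop 20 1 (addMany 5 21 1 (.add (.reg 3) (.lit 1))))
      (assign 5 (.add (.add (.reg 5) (.reg 1)) (.lit 1)))

/-- Compute the bound for the size of balls. -/
def setBallBound : BProg :=
  seq (assign 6 (.lit 1)) <| loop 20 1 <| seq (assign 18 (.lit 0)) <|
    seq (addMany 18 21 5 (.reg 6)) (assign 6 (.reg 18))

/-- Compute the number of balls in a layer. -/
def setBallCount : BProg := seq (assign 7 (.lit 1)) (addMany 7 20 1 (.reg 6))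

/-- Compute the bound for the size of the kernel. -/
def setKernelBound : BProg :=
  seq (assign 8 (.lit 0)) (loop 20 4 (addMany 8 21 7 (.reg 6)))

/-- Compute the number of rounds of the enumeration of subsets, and the radius of the balls. -/
def setRounds (goal : CutGoal) : BProg :=
  seq (assign 9 (.lit 1)) <| seq (loop 20 8 (assign 9 (.add (.reg 9) (.reg 9))))
    (assign 10 (match goal with | .max => .lit 0 | .min => .reg 1))

/-- The program. -/
def program (goal : CutGoal) : BProg :=
  seq setDegBound <| seq setBallBound <| seq setBallCount <| seq setKernelBound <|
    seq (setRounds goal) (solve goal)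

@[simp] theorem regs_addMany (x c r : ℕ) (e : RExpr) : (addMany x c r e).regs = [c, x] := rfl
@[simp] theorem regs_setDegBound : setDegBound.regs = [4, 5, 20, 21, 5, 5] := rfl
@[simp] theorem regs_setBallBound : setBallBound.regs = [6, 20, 18, 21, 18, 6] := rfl
@[simp] theorem regs_setBallCount : setBallCount.regs = [7, 20, 7] := rfl
@[simp] theorem regs_setKernelBound : setKernelBound.regs = [8, 20, 21, 8] := rfl
@[simp] theorem regs_setRounds (goal : CutGoal) : (setRounds goal).regs = [9, 20, 9, 10] := rfl
@[simp] theorem arrs_setDegBound : setDegBound.arrs = [] := rfl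
@[simp] theorem arrs_setBallBound : setBallBound.arrs = [] := rfl
@[simp] theorem arrs_setBallCount : setBallCount.arrs = [] := rfl
@[simp] theorem arrs_setKernelBound : setKernelBound.arrs = [] := rfl
@[simp] theorem arrs_setRounds (goal : CutGoal) : (setRounds goal).arrs = [] := rfl

theorem setDegBound_reg {s : RState} {k d : ℕ} (h1 : s.reg 1 = k) (h3 : s.reg 3 = d) :
    (setDegBound.run s).reg 4 = k + 1 ∧ (setDegBound.run s).reg 5 = degBound k d := by
  set s₁ := (s.setReg 4 (k + 1)).setReg 5 0 with hs₁
  have key := run_loop (x := 20) (r := 1) (p := addMany 5 21 1 (.add (.reg 3) (.lit 1))) (s := s₁)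
    (fun i t => t.reg 5 = i * (k * (d + 1))) (by simp [hs₁]) (fun i hi t ht hti hr ha => ?_)
  · set t := (loop 20 1 (addMany 5 21 1 (.add (.reg 3) (.lit 1)))).run s₁ with ht
    have hrun : setDegBound.run s = t.setReg 5 (t.reg 5 + t.reg 1 + 1) := by
      simp only [setDegBound, run_seq, run_assign, RExpr.eval, h1, ht, hs₁]
    have ht1 : t.reg 1 = k := by rw [ht, run_reg (by simp [regs])]; simp [hs₁, h1]
    have ht4 : t.reg 4 = k + 1 := by rw [ht, run_reg (by simp [regs])]; simp [hs₁]
    have hs11 : s₁.reg 1 = k := by simp [hs₁, h1]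
    rw [hrun]
    simp [ht1, ht4, key, hs11, degBound]
  · have ht3 : t.reg 3 = d := by rw [hr 3 (by simp [regs])]; simp [hs₁, h3]
    have ht1 : t.reg 1 = k := by rw [hr 1 (by simp [regs])]; simp [hs₁, h1]
    rw [RState.setReg_reg, if_neg (by norm_num), addMany_reg (by norm_num) (d + 1)
      (fun t' ht' => by simp [ht' 3 (by simp), ht3]), ht, ht1]
    ring

theorem setBallBound_reg {s : RState} {k D : ℕ} (h1 : s.reg 1 = k) (h5 : s.reg 5 = D) :
    (setBallBound.run s).reg 6 = D ^ k := by
  have key := run_loop (x := 20) (r := 1) (p := seq (assign 18 (.lit 0)) <|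
    seq (addMany 18 21 5 (.reg 6)) (assign 6 (.reg 18))) (s := s.setReg 6 1)
    (fun i t => t.reg 6 = D ^ i) (by simp) (fun i hi t ht hti hr ha => ?_)
  · simpa [setBallBound, h1] using key
  · have ht5 : t.reg 5 = D := by rw [hr 5 (by simp [regs])]; simp [h5]
    have h18 := addMany_reg (x := 18) (c := 21) (r := 5) (e := .reg 6) (s := t.setReg 18 0)
      (by norm_num) (D ^ i) (fun t' ht' => by simp [ht' 6 (by simp), ht])
    simp [h18, ht5, pow_succ']

theorem setBallCount_reg {s : RState} {k b : ℕ} (h1 : s.reg 1 = k) (h6 : s.reg 6 = b) :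
    (setBallCount.run s).reg 7 = 1 + k * b := by
  have := addMany_reg (x := 7) (c := 20) (r := 1) (e := .reg 6) (s := s.setReg 7 1)
    (by norm_num) b (fun t' ht' => by simp [ht' 6 (by simp), h6])
  simpa [setBallCount, h1] using this

theorem setKernelBound_reg {s : RState} {m b M : ℕ} (h4 : s.reg 4 = m) (h6 : s.reg 6 = b)
    (h7 : s.reg 7 = M) : (setKernelBound.run s).reg 8 = m * (M * b) := by
  have key := run_loop (x := 20) (r := 4) (p := addMany 8 21 7 (.reg 6)) (s := s.setReg 8 0)
    (fun i t => t.reg 8 = i * (M * b)) (by simp) (fun i hi t ht hti hr ha => ?_)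
  · simpa [setKernelBound, h4] using key
  · have ht6 : t.reg 6 = b := by rw [hr 6 (by simp [regs])]; simp [h6]
    have ht7 : t.reg 7 = M := by rw [hr 7 (by simp [regs])]; simp [h7]
    rw [RState.setReg_reg, if_neg (by norm_num), addMany_reg (by norm_num) b
      (fun t' ht' => by simp [ht' 6 (by simp), ht6]), ht, ht7]
    ring

/-- The radius of the balls. -/
def radius (goal : CutGoal) (k : ℕ) : ℕ :=
  match goal with
  | .max => 0
  | .min => k

theorem setRounds_reg (goal : CutGoal) {s : RState} {k c : ℕ} (h1 : s.reg 1 = k)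
    (h8 : s.reg 8 = c) : ((setRounds goal).run s).reg 9 = 2 ^ c ∧
      ((setRounds goal).run s).reg 10 = radius goal k := by
  have key := run_loop (x := 20) (r := 8) (p := assign 9 (.add (.reg 9) (.reg 9)))
    (s := s.setReg 9 1) (fun i t => t.reg 9 = 2 ^ i) (by simp) (fun i hi t ht hti hr ha => ?_)
  · have h1' := run_reg (p := loop 20 8 (assign 9 (.add (.reg 9) (.reg 9)))) (y := 1)
      (by simp [regs]) (s.setReg 9 1)
    have h9 : (s.setReg 9 1).reg 8 = c := by simp [h8]
    rw [h9] at key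
    cases goal <;> simp [setRounds, radius, key, h1', h1]
  · simp [ht]; ring

/-! ### Running time -/

/-- The program halts within `T` steps. -/
def HaltsWithin (p : BProg) (s : RState) (T : ℕ) : Prop :=
  ∃ t ≤ T, RExec p.toRProg s (p.run s) t

/-- Later phases have loop bounds that earlier phases compute, so `exists_exec` applies only phase
by phase. The common factor `c` lets the weights add up. -/
theorem HaltsWithin.seq {p q : BProg} {s : RState} {a b c : ℕ} (hp : HaltsWithin p s (a * c))
    (hq : HaltsWithin q (p.run s) (b * c)) : HaltsWithin (seq p q) s ((a + b) * c) := by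
  obtain ⟨t₁, h₁, e₁⟩ := hp
  obtain ⟨t₂, h₂, e₂⟩ := hq
  exact ⟨t₁ + t₂, by rw [add_mul]; omega, .seq e₁ e₂⟩

theorem haltsWithin {p : BProg} (hp : p.CountersKept) (hb : ∀ r ∈ p.bounds, r ∉ p.regs)
    {m : ℕ} (hm : p.depth ≤ m) {s : RState} {B : ℕ} (hB : ∀ r ∈ p.bounds, s.reg r ≤ B) :
    HaltsWithin p s (p.weight * (B + 1) ^ m) := by
  obtain ⟨t, ht, h⟩ := exists_exec p hp hb s B hB
  exact ⟨t, ht.trans (Nat.mul_le_mul_left _ (Nat.pow_le_pow_right (by omega) hm)), h⟩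

/-- The constant in the running time. -/
def totalWeight (goal : CutGoal) : ℕ :=
  setDegBound.weight + (setBallBound.weight + (setBallCount.weight + (setKernelBound.weight +
    ((setRounds goal).weight + (solve goal).weight))))

/-- The part of the running time that depends on the parameters. -/
def timeFactor (goal : CutGoal) (p : ℕ × ℕ × ℕ) : ℕ :=
  totalWeight goal * (2 * 2 ^ kernelBound p.1 p.2.2) ^ 5

theorem computable_timeFactor (goal : CutGoal) : Computable (timeFactor goal) := by
  have hpow : Primrec₂ ((· ^ ·) : ℕ → ℕ → ℕ) := Primrec₂.unpaired'.1 Nat.Primrec.pow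
  have hk : Primrec fun p : ℕ × ℕ × ℕ => p.1 := Primrec.fst
  have hd : Primrec fun p : ℕ × ℕ × ℕ => p.2.2 := Primrec.snd.comp Primrec.snd
  have h1 : Primrec fun _ : ℕ × ℕ × ℕ => 1 := Primrec.const 1
  have hD : Primrec fun p : ℕ × ℕ × ℕ => degBound p.1 p.2.2 :=
    Primrec.nat_add.comp (Primrec.nat_add.comp (Primrec.nat_mul.comp hk
      (Primrec.nat_mul.comp hk (Primrec.nat_add.comp hd h1))) hk) h1
  have hb : Primrec fun p : ℕ × ℕ × ℕ => degBound p.1 p.2.2 ^ p.1 := hpow.comp hD hk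
  have hM : Primrec fun p : ℕ × ℕ × ℕ => ballCount p.1 p.2.2 :=
    Primrec.nat_add.comp h1 (Primrec.nat_mul.comp hk hb)
  have hc : Primrec fun p : ℕ × ℕ × ℕ => kernelBound p.1 p.2.2 :=
    Primrec.nat_mul.comp (Primrec.nat_add.comp hk h1) (Primrec.nat_mul.comp hM hb)
  exact (Primrec.nat_mul.comp (Primrec.const _) (hpow.comp (Primrec.nat_mul.comp (Primrec.const 2)
    (hpow.comp (Primrec.const 2) hc)) (Primrec.const 5))).to_comp

theorem degBound_pos (k d : ℕ) : 0 < degBound k d := Nat.succ_pos _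

theorem degBound_le_pow (k d : ℕ) : degBound k d ≤ degBound k d ^ k := by
  rcases Nat.eq_zero_or_pos k with rfl | hk
  · simp [degBound]
  · exact Nat.le_self_pow hk.ne' _

theorem pow_le_kernelBound (k d : ℕ) : degBound k d ^ k ≤ kernelBound k d :=
  (Nat.le_mul_of_pos_left _ (by unfold ballCount; omega)).trans
    (Nat.le_mul_of_pos_left _ (by omega))

theorem ballCount_le_kernelBound (k d : ℕ) : ballCount k d ≤ kernelBound k d :=
  (Nat.le_mul_of_pos_right _ (Nat.pow_pos (degBound_pos k d))).trans
    (Nat.le_mul_of_pos_left _ (by omega))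

/-! ### The whole program: running time and approximation guarantee -/

section

variable {n : ℕ} {G : SimpleGraph (Fin n)}

/-- Division with remainder by `n` recovers the pair `(u, v)` from the index `u * n + v`. -/
theorem hasGraph_cutInput (G : SimpleGraph (Fin n)) (k : ℕ) (ε : ℚ) (coins : ℕ → Bool) :
    HasGraph G (cutInput G k ε coins) := by
  classical
  refine ⟨rfl, fun u v => ?_⟩
  have h : (∃ u' v' : Fin n, G.Adj u' v' ∧ (u : ℕ) * n + v = u' * n + v') ↔ G.Adj u v := by
    constructor
    · rintro ⟨u', v', h, he⟩
      have hv : v = v' := Fin.ext <| by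
        simpa [Nat.mul_add_mod', Nat.mod_eq_of_lt] using congrArg (· % n) he
      subst hv
      have hu : u = u' := Fin.ext (Nat.eq_of_mul_eq_mul_right v.pos (Nat.add_right_cancel he))
      rwa [hu]
    · exact fun h => ⟨u, v, h, rfl⟩
  simp only [cutInput, true_and, h]

/-- The program halts in time, and its output is as good as any set of `k` vertices in the
kernel. -/
theorem program_exec (goal : CutGoal) {k : ℕ} (hk : k ≤ n) (ε : ℚ) (coins : ℕ → Bool) :
    ∃ (s : RState) (t : ℕ), RExec (program goal).toRProg (cutInput G k ε coins) s t ∧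
      t ≤ fptBound (timeFactor goal) 5 n k ε ∧
      ∀ Z ⊆ kernel G goal (degBound k ε.den) (radius goal k) (ballCount k ε.den) k, Z.card = k →
        (cutOutput n s).card = k ∧ score G goal Z ≤ score G goal (cutOutput n s) := by
  set d := ε.den with hd
  set s₀ := cutInput G k ε coins with hs₀
  have hG : HasGraph G s₀ := hasGraph_cutInput G k ε coins
  have h01 : s₀.reg 1 = k := rfl
  have h03 : s₀.reg 3 = d := rfl
  set s₁ := setDegBound.run s₀ with hs₁
  obtain ⟨h14, h15⟩ := setDegBound_reg h01 h03
  rw [← hs₁] at h14 h15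
  have h11 : s₁.reg 1 = k := by rw [hs₁, run_reg (by simp), h01]
  set s₂ := setBallBound.run s₁ with hs₂
  have h26 := setBallBound_reg h11 h15
  have h21 : s₂.reg 1 = k := by rw [hs₂, run_reg (by simp), h11]
  set s₃ := setBallCount.run s₂ with hs₃
  have h37 : s₃.reg 7 = ballCount k d := by
    rw [hs₃, setBallCount_reg h21 h26, ballCount]
  have h36 : s₃.reg 6 = degBound k d ^ k := by rw [hs₃, run_reg (by simp), h26]
  have h34 : s₃.reg 4 = k + 1 := by rw [hs₃, run_reg (by simp), hs₂, run_reg (by simp), h14]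
  set s₄ := setKernelBound.run s₃ with hs₄
  have h48 : s₄.reg 8 = kernelBound k d := by
    rw [hs₄, setKernelBound_reg h34 h36 h37, kernelBound]
  have h41 : s₄.reg 1 = k := by rw [hs₄, run_reg (by simp), hs₃, run_reg (by simp), h21]
  set s₅ := (setRounds goal).run s₄ with hs₅
  obtain ⟨h59, h510⟩ := setRounds_reg goal h41 h48
  rw [← hs₅] at h59 h510
  have h51 : s₅.reg 1 = k := by rw [hs₅, run_reg (by simp), h41]
  have h54 : s₅.reg 4 = k + 1 := by
    rw [hs₅, run_reg (by simp), hs₄, run_reg (by simp), h34]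
  have h55 : s₅.reg 5 = degBound k d := by
    rw [hs₅, run_reg (by simp), hs₄, run_reg (by simp), hs₃, run_reg (by simp), hs₂,
      run_reg (by simp), h15]
  have h57 : s₅.reg 7 = ballCount k d := by
    rw [hs₅, run_reg (by simp), hs₄, run_reg (by simp), h37]
  have h50 : s₅.reg 0 = n := by
    rw [hs₅, run_reg (by simp), hs₄, run_reg (by simp), hs₃, run_reg (by simp), hs₂,
      run_reg (by simp), hs₁, run_reg (by simp)]
    rfl
  have hG₅ : HasGraph G s₅ := hG.of_eq (by rw [h50]; rfl) (by
    rw [hs₅, run_arr (by simp), hs₄, run_arr (by simp), hs₃, run_arr (by simp), hs₂,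
      run_arr (by simp), hs₁, run_arr (by simp)])
  have hrun : (program goal).run s₀ = (solve goal).run s₅ := by
    simp only [program, run_seq, ← hs₁, ← hs₂, ← hs₃, ← hs₄, ← hs₅]
  have hrad : radius goal k ≤ k := by cases goal <;> simp [radius]
  set E := 2 ^ kernelBound k d with hE
  have hE1 : 1 ≤ E := Nat.one_le_two_pow
  have hKE : kernelBound k d ≤ E := Nat.lt_two_pow_self.le
  have hDE : degBound k d ≤ E :=
    (degBound_le_pow k d).trans ((pow_le_kernelBound k d).trans hKE)
  have hME : ballCount k d ≤ E := (ballCount_le_kernelBound k d).trans hKE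
  -- A common bound for all loops: the bounds are `n`, `k`, `k + 1`, the radius or parameters, and
  -- the parameters are at most `E`.
  set B := E * (n + 1) with hB
  have hnB : n + 1 ≤ B := Nat.le_mul_of_pos_left _ hE1
  have hEB : E ≤ B := Nat.le_mul_of_pos_right _ (by omega)
  have hT : HaltsWithin (program goal) s₀ (totalWeight goal * (B + 1) ^ 5) := by
    refine .seq (haltsWithin (by decide) (by decide) (by decide) ?_) <|
      .seq (haltsWithin (by decide) (by decide) (by decide) ?_) <|
      .seq (haltsWithin (by decide) (by decide) (by decide) ?_) <|
      .seq (haltsWithin (by decide) (by decide) (by decide) ?_) <|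
      .seq (haltsWithin (by cases goal <;> decide) (by cases goal <;> decide)
        (by cases goal <;> decide) ?_)
      (haltsWithin (by cases goal <;> decide) (by cases goal <;> decide)
        (by cases goal <;> decide) ?_)
    · have : ∀ r ∈ setDegBound.bounds, r = 1 := by decide
      intro r hr
      rw [this r hr]
      omega
    · have : ∀ r ∈ setBallBound.bounds, r = 1 ∨ r = 5 := by decide
      intro r hr
      change s₁.reg r ≤ B
      rcases this r hr with rfl | rfl <;> omega
    · have : ∀ r ∈ setBallCount.bounds, r = 1 := by decide
      intro r hr
      change s₂.reg r ≤ B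
      rw [this r hr]
      omega
    · have : ∀ r ∈ setKernelBound.bounds, r = 4 ∨ r = 7 := by decide
      intro r hr
      change s₃.reg r ≤ B
      rcases this r hr with rfl | rfl <;> omega
    · have : ∀ r ∈ (setRounds goal).bounds, r = 8 := by cases goal <;> decide
      intro r hr
      change s₄.reg r ≤ B
      rw [this r hr]
      omega
    · have : ∀ r ∈ (solve goal).bounds, r = 0 ∨ r = 4 ∨ r = 9 ∨ r = 10 := by
        cases goal <;> decide
      intro r hr
      change s₅.reg r ≤ B
      rcases this r hr with rfl | rfl | rfl | rfl <;> omega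
  obtain ⟨t, ht, hexec⟩ := hT
  refine ⟨_, t, hexec, ht.trans ?_, fun Z hZ hZk => ?_⟩
  · simp only [fptBound, timeFactor, mul_assoc]
    refine Nat.mul_le_mul_left _ ?_
    rw [← mul_pow]
    -- The nesting depth is at most 5, and `B + 1 ≤ 2 * E * (n + 1)` separates the parameter from
    -- `n`.
    exact Nat.pow_le_pow_left (by rw [mul_assoc]; change B + 1 ≤ 2 * B; omega) 5
  · rw [hrun]
    refine solve_run goal hG₅ (degBound_pos k d) h51 h54 h55 h57 h510 ?_
      (by unfold ballCount; omega) hZ hZk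
    -- `kernelBound` is computed with radius `k`, which also covers radius 0.
    rw [h59]
    exact Nat.pow_le_pow_right (by norm_num) (Nat.mul_le_mul_left _ (Nat.mul_le_mul_left _
      (Nat.pow_le_pow_right (degBound_pos k d) hrad)))

theorem lt_degBound (k d : ℕ) : k ^ 2 * (d + 1) + k < degBound k d := by
  unfold degBound
  nlinarith

theorem mul_pow_lt_ballCount (k d : ℕ) : k * degBound k d ^ k < ballCount k d := by
  unfold ballCount
  omega

/-- The numerator is at least 1. Hence accuracy `1 / ε.den` suffices, and the program never needs
the numerator. -/
theorem one_le_mul_den {ε : ℚ} (hε : 0 < ε) : 1 ≤ ε * ε.den := by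
  rw [Rat.mul_den_eq_num]
  exact_mod_cast Rat.num_pos.2 hε

theorem exists_card_eq {k : ℕ} (hk : k ≤ n) : ∃ W : Finset (Fin n), W.card = k := by
  obtain ⟨W, -, hW⟩ := Finset.exists_subset_card_eq (s := (Finset.univ : Finset (Fin n)))
    (by simpa using hk)
  exact ⟨W, hW⟩

/-- Within the time bound the program outputs an approximate solution, for both goals. -/
theorem program_isApproxCut (goal : CutGoal) {k : ℕ} (hk : k ≤ n) {ε : ℚ} (hε : 0 < ε)
    (G : SimpleGraph (Fin n)) (coins : ℕ → Bool) :
    ∃ (s : RState) (t : ℕ), RExec (program goal).toRProg (cutInput G k ε coins) s t ∧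
      t ≤ fptBound (timeFactor goal) 5 n k ε ∧ IsApproxCut goal G k ε (cutOutput n s) := by
  obtain ⟨s, t, hs, ht, h⟩ := program_exec (G := G) goal hk ε coins
  refine ⟨s, t, hs, ht, ?_⟩
  have hd := lt_degBound k ε.den
  have hM := mul_pow_lt_ballCount k ε.den
  have hε' := one_le_mul_den hε
  have hden : (0 : ℚ) < ε.den := by exact_mod_cast ε.den_pos
  cases goal with
  | max =>
    have hM' : k * degBound k ε.den < ballCount k ε.den :=
      (Nat.mul_le_mul_left _ (degBound_le_pow k ε.den)).trans_lt hM
    -- The kernel set for maximization depends on the competitor `W`, so some `W₀` is fixed to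
    -- obtain the size of the output.
    obtain ⟨W₀, hW₀⟩ := exists_card_eq hk
    obtain ⟨Z₀, hZ₀, hZ₀k, -⟩ := exists_subset_kernel_max (G := G) hk hd hM' W₀ hW₀
    refine ⟨(h Z₀ hZ₀ hZ₀k).1, fun W hW => ?_⟩
    obtain ⟨Z, hZ, hZk, hZW⟩ := exists_subset_kernel_max (G := G) hk hd hM' W hW
    have hle := score_max_le_iff.1 (h Z hZ hZk).2
    have h1 : (ε.den : ℚ) * cutValue G W ≤ ε.den * cutValue G Z + cutValue G W := by
      exact_mod_cast hZW
    have h2 : (cutValue G Z : ℚ) ≤ cutValue G (cutOutput n s) := by exact_mod_cast hle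
    have h3 : (cutValue G W : ℚ) ≤ ε * ε.den * cutValue G W :=
      le_mul_of_one_le_left (by positivity) hε'
    refine le_of_mul_le_mul_left ?_ hden
    have h4 := mul_le_mul_of_nonneg_left h2 hden.le
    linarith
  | min =>
    obtain ⟨Z, hZ, hZk, hZW⟩ := exists_subset_kernel_min (G := G) hk hd hM
    refine ⟨(h Z hZ hZk).1, fun W hW => ?_⟩
    have hle := score_min_le_iff.1 (h Z hZ hZk).2
    have h1 : (ε.den : ℚ) * cutValue G Z ≤ (ε.den + 1) * cutValue G W := by
      exact_mod_cast hZW W hW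
    have h2 : (cutValue G (cutOutput n s) : ℚ) ≤ cutValue G Z := by exact_mod_cast hle
    have h3 : (cutValue G W : ℚ) ≤ ε * ε.den * cutValue G W :=
      le_mul_of_one_le_left (by positivity) hε'
    refine le_of_mul_le_mul_left ?_ hden
    have h4 := mul_le_mul_of_nonneg_left h2 hden.le
    linarith

end

end CutProg

instance : MeasureTheory.IsProbabilityMeasure coinMeasure := by
  unfold coinMeasure
  infer_instance

theorem mainTheorem5 :
    HasFPTApproxSchema CutGoal.max ∧ HasRandomizedFPTApproxSchema CutGoal.min := by
  refine ⟨⟨(CutProg.program .max).toRProg, CutProg.timeFactor .max, 5,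
    BProg.toRProg_coinFree _, CutProg.computable_timeFactor _, fun ε hε n k hk G =>
      CutProg.program_isApproxCut .max hk hε G _⟩,
    ⟨(CutProg.program .min).toRProg, CutProg.timeFactor .min, 5,
      CutProg.computable_timeFactor _, fun ε hε n k hk G => ⟨fun coins => ?_, ?_⟩⟩⟩
  · obtain ⟨s, t, hs, ht, h⟩ := CutProg.program_isApproxCut .min hk hε G coins
    exact ⟨s, t, hs, ht, h.1⟩
  -- The guarantee holds for every sequence of coins, so the event is the whole space.
  · have huniv : {coins | ∃ (s : RState) (t : ℕ),
        RExec (CutProg.program .min).toRProg (cutInput G k ε coins) s t ∧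
        IsApproxCut .min G k ε (cutOutput n s)} = Set.univ := by
      refine Set.eq_univ_of_forall fun coins => ?_
      obtain ⟨s, t, hs, -, h⟩ := CutProg.program_isApproxCut .min hk hε G coins
      exact ⟨s, t, hs, h⟩
    rw [huniv, MeasureTheory.measure_univ]
    exact ENNReal.div_le_of_le_mul (by norm_num)
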